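/- Let $\mathbb Z[\varepsilon]=\mathbb Z[T]/(T^2)$ be the ring of dual integers. All modules are finitely generated. A $\mathbb Z[\varepsilon]$-module $M$ is *Gorenstein-projective* if $M\cong\operatorname{Ker}(d^0)$ for some doubly infinite exact sequence $P^\bullet:\ \cdots\to P^{-1}\to P^0\xrightarrow{d^0}P^1\to\cdots$ of finitely generated projective $\mathbb Z[\varepsilon]$-modules such that $\operatorname{Hom}(P^\bullet,\mathbb Z[\varepsilon])$ is exact; it is *torsionless* if it is isomorphic to a submodule of $\mathbb Z[\varepsilon]^n$ for some $n$. A *differential $\mathbb Z$-structure* is a pair $(N,e)$ of a finitely generated abelian group $N$ and an endomorphism $e$ of $N$ with $e^2=0$; a morphism $(N,e)\to(N',e')$ is a homomorphism $f:N\to N'$ with $e'f=fe$. It is *perfect* if $N$ is projective (i.e. free). A morphism $f:(N,e)\to(N',e')$ is *homotopic to zero* if $f=he+e'h$ for some homomorphism $h:N\to N'$. **Theorem 1.1.** The following five categories are equivalent: (a) the stable category of Gorenstein-projective $\mathbb Z[\varepsilon]$-modules, that is, Gorenstein-projective $\mathbb Z[\varepsilon]$-modules with homomorphisms modulo those that factor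 through a projective $\mathbb Z[\varepsilon]$-module; (b) the stable category of torsionless $\mathbb Z[\varepsilon]$-modules, that is, torsionless $\mathbb Z[\varepsilon]$-modules with homomorphisms modulo those that factor through a projective $\mathbb Z[\varepsilon]$-module; (c) the orbit category $\mathcal D^b(\mathbb Z)/[1]$ of the bounded derived category of the category of finitely generated abelian groups, which has the same objects as $\mathcal D^b(\mathbb Z)$, morphism groups $\operatorname{Hom}(X,Y)=\bigoplus_{i\in\mathbb Z}\operatorname{Hom}_{\mathcal D^b(\mathbb Z)}(X,Y[i])$, and the composition induced by $(f,g)\mapsto g[i]\circ f$ for $f:X\to Y[i]$, $g:Y\to Z[j]$; (d) the homotopy category of perfect differential $\mathbb Z$-structures, that is, perfect differential $\mathbb Z$-structures with morphisms modulo those homotopic to zero; (e) the stable category of perfect differential $\mathbb Z$-structures, that is, perfect differential $\mathbb Z$-structures with morphisms modulo those that factor through a projective object of the category of all differential $\mathbb Z$-structures. -/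

import Mathlib

open CategoryTheory

open scoped DirectSum

noncomputable section

universe v u

/-! ### Stable categories -/

/-- Two parallel morphisms of the full subcategory of `A` on the objects satisfying `S` are
stably equal if their difference factors through an object of this subcategory which is
projective in the ambient category `A`. -/
def stableRel {A : Type u} [Category.{v} A] [Preadditive A] (S : ObjectProperty A) :
    HomRel S.FullSubcategory :=
  fun X Y f g => ∃ (Q : S.FullSubcategory) (_ : Projective Q.obj) (a : X ⟶ Q) (b : Q ⟶ Y),
    f - g = a ≫ b

/-- The stable category, modulo projectives, of the full subcategory of `A` on the objects
satisfying `S`: same objects, morphisms modulo those which factor through a projective. -/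
abbrev StableCat {A : Type u} [Category.{v} A] [Preadditive A] (S : ObjectProperty A) :
    Type u :=
  CategoryTheory.Quotient (stableRel S)

/-! ### Torsionless and Gorenstein-projective modules -/

/-- A finitely generated module is torsionless if it embeds into a free module `Rⁿ`. -/
def IsTorsionless (R : Type u) [Ring R] : ObjectProperty (FGModuleCat.{u} R) :=
  fun M => ∃ (n : ℕ) (f : M →ₗ[R] (Fin n → R)), Function.Injective f

/-- A finitely generated module `M` over a commutative ring `R` is Gorenstein-projective if
`M ≅ Ker d⁰` for a doubly infinite exact sequence `⋯ ⟶ P⁻¹ ⟶ P⁰ ⟶ P¹ ⟶ ⋯` of finitely generated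
projective modules whose dual sequence `Hom_R(P, R)` is exact. -/
def IsGorensteinProjective (R : Type u) [CommRing R] : ObjectProperty (FGModuleCat.{u} R) :=
  fun M => ∃ (P : ℤ → FGModuleCat.{u} R) (d : ∀ i : ℤ, P i →ₗ[R] P (i + 1)),
    (∀ i, Module.Projective R (P i)) ∧
    (∀ i, Function.Exact (d i) (d (i + 1))) ∧
    (∀ i, Function.Exact (d (i + 1)).dualMap (d i).dualMap) ∧
    Nonempty (M ≃ₗ[R] LinearMap.ker (d 0))

/-! ### Differential structures -/

/-- A differential structure in `C`: an object with an endomorphism of square zero. -/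
structure DiffStr (C : Type u) [Category.{v} C] [Preadditive C] where
  /-- the underlying object -/
  obj : C
  /-- the differential -/
  d : obj ⟶ obj
  d_d : d ≫ d = 0

namespace DiffStr

variable {C : Type u} [Category.{v} C] [Preadditive C]

/-- A morphism of differential structures commutes with the differentials. -/
@[ext]
structure Hom (X Y : DiffStr C) where
  /-- the underlying morphism -/
  f : X.obj ⟶ Y.obj
  comm : f ≫ Y.d = X.d ≫ f

instance : Category.{v} (DiffStr C) where
  Hom X Y := Hom X Y
  id X := ⟨𝟙 X.obj, by simp⟩
  comp g h := ⟨g.f ≫ h.f, by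
    rw [Category.assoc, h.comm, ← Category.assoc, g.comm, Category.assoc]⟩
  id_comp g := Hom.ext (Category.id_comp g.f)
  comp_id g := Hom.ext (Category.comp_id g.f)
  assoc g h k := Hom.ext (Category.assoc g.f h.f k.f)

@[ext]
lemma hom_ext {X Y : DiffStr C} {g h : X ⟶ Y} (w : g.f = h.f) : g = h := Hom.ext w

@[simp] lemma id_f (X : DiffStr C) : Hom.f (𝟙 X) = 𝟙 X.obj := rfl

@[simp] lemma comp_f {X Y Z : DiffStr C} (g : X ⟶ Y) (h : Y ⟶ Z) :
    (g ≫ h).f = g.f ≫ h.f := rfl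

instance (X Y : DiffStr C) : Zero (X ⟶ Y) := ⟨⟨0, by simp⟩⟩

instance (X Y : DiffStr C) : Add (X ⟶ Y) := ⟨fun g h => ⟨g.f + h.f, by
  simp only [Preadditive.add_comp, Preadditive.comp_add, g.comm, h.comm]⟩⟩

instance (X Y : DiffStr C) : Neg (X ⟶ Y) := ⟨fun g => ⟨-g.f, by
  simp only [Preadditive.neg_comp, Preadditive.comp_neg, g.comm]⟩⟩

@[simp] lemma zero_f (X Y : DiffStr C) : (0 : X ⟶ Y).f = 0 := rfl

@[simp] lemma add_f {X Y : DiffStr C} (g h : X ⟶ Y) : (g + h).f = g.f + h.f := rfl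

@[simp] lemma neg_f {X Y : DiffStr C} (g : X ⟶ Y) : (-g).f = -g.f := rfl

instance (X Y : DiffStr C) : AddCommGroup (X ⟶ Y) where
  add_assoc a b c := hom_ext (add_assoc a.f b.f c.f)
  zero_add a := hom_ext (zero_add a.f)
  add_zero a := hom_ext (add_zero a.f)
  nsmul := nsmulRec
  zsmul := zsmulRec
  neg_add_cancel a := hom_ext (neg_add_cancel a.f)
  add_comm a b := hom_ext (add_comm a.f b.f)

instance : Preadditive (DiffStr C) where
  add_comp X Y Z a b c := hom_ext (Preadditive.add_comp _ _ _ a.f b.f c.f)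
  comp_add X Y Z a b c := hom_ext (Preadditive.comp_add _ _ _ a.f b.f c.f)

/-- A differential structure is perfect if its underlying object is projective in `C`. -/
def IsPerfect (C : Type u) [Category.{v} C] [Preadditive C] : ObjectProperty (DiffStr C) :=
  fun X => Projective X.obj

/-- Two morphisms `(N, e) ⟶ (N', e')` of perfect differential structures are homotopic if their
difference is of the form `h e + e' h` for some morphism `h : N ⟶ N'` in `C`. -/
def homotopyRel (C : Type u) [Category.{v} C] [Preadditive C] :
    HomRel (IsPerfect C).FullSubcategory :=
  fun X Y f g => ∃ h : X.obj.obj ⟶ Y.obj.obj,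
    f.hom.f - g.hom.f = X.obj.d ≫ h + h ≫ Y.obj.d

/-- The homotopy category of perfect differential structures. -/
abbrev HomotopyCat (C : Type u) [Category.{v} C] [Preadditive C] : Type (max u v) :=
  CategoryTheory.Quotient (homotopyRel C)

end DiffStr

/-! ### Orbit categories -/

/-- The orbit category `C/[1]` of a preadditive category with an additive shift by `ℤ`.
It has the same objects as `C`. -/
structure OrbitCat (C : Type u) where
  /-- a representative of the orbit -/
  as : C

namespace OrbitCat

variable {C : Type u} [Category.{v} C] [Preadditive C] [HasShift C ℤ]

/-- Morphisms in the orbit category: `⨁ i, Hom(X, Y[i])`. -/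
abbrev Hom (X Y : C) : Type v := ⨁ i : ℤ, ShiftedHom X Y i

variable [∀ i : ℤ, (shiftFunctor C i).Additive]

/-- The composition `Hom(X, Y[i]) × Hom(Y, Z[j]) → Hom(X, Z[j + i])`, `(f, g) ↦ g[i] ∘ f`,
followed by the inclusion into `⨁ k, Hom(X, Z[k])`. -/
def compAux (X Y Z : C) (i j : ℤ) : ShiftedHom X Y i →+ ShiftedHom Y Z j →+ Hom X Z :=
  AddMonoidHom.mk' (fun f => AddMonoidHom.mk'
      (fun g => DirectSum.of (fun k : ℤ => ShiftedHom X Z k) (j + i) (f.comp g rfl))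
      (fun g g' => by rw [ShiftedHom.comp_add, map_add]))
    (fun f f' => by
      ext g
      simp only [AddMonoidHom.mk'_apply, AddMonoidHom.add_apply, ShiftedHom.add_comp, map_add])

/-- The biadditive composition of the orbit category. -/
def compHom (X Y Z : C) : Hom X Y →+ Hom Y Z →+ Hom X Z :=
  DirectSum.toAddMonoid fun i =>
    (DirectSum.toAddMonoid fun j => (compAux X Y Z i j).flip).flip

lemma compHom_of_of {X Y Z : C} {i j k : ℤ} (h : j + i = k) (f : ShiftedHom X Y i)
    (g : ShiftedHom Y Z j) :
    compHom X Y Z (DirectSum.of (fun n : ℤ => ShiftedHom X Y n) i f)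
        (DirectSum.of (fun n : ℤ => ShiftedHom Y Z n) j g) =
      DirectSum.of (fun n : ℤ => ShiftedHom X Z n) k (f.comp g h) := by
  subst h
  simp [compHom, compAux]

lemma id_compHom {X Y : C} (f : Hom X Y) :
    compHom X X Y (DirectSum.of (fun n : ℤ => ShiftedHom X X n) 0
      (ShiftedHom.mk₀ 0 rfl (𝟙 X))) f = f := by
  induction f using DirectSum.induction_on with
  | zero => simp
  | of i f => rw [compHom_of_of (add_zero i), ShiftedHom.mk₀_id_comp]
  | add f g hf hg => rw [map_add, hf, hg]

lemma compHom_id {X Y : C} (f : Hom X Y) :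
    compHom X Y Y f (DirectSum.of (fun n : ℤ => ShiftedHom Y Y n) 0
      (ShiftedHom.mk₀ 0 rfl (𝟙 Y))) = f := by
  induction f using DirectSum.induction_on with
  | zero => simp
  | of i f => rw [compHom_of_of (zero_add i), ShiftedHom.comp_mk₀_id]
  | add f g hf hg => rw [map_add, AddMonoidHom.add_apply, hf, hg]

lemma compHom_assoc {X Y Z T : C} (f : Hom X Y) (g : Hom Y Z) (h : Hom Z T) :
    compHom X Z T (compHom X Y Z f g) h = compHom X Y T f (compHom Y Z T g h) := by
  induction f using DirectSum.induction_on with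
  | zero => simp
  | add f f' hf hf' => simp only [map_add, AddMonoidHom.add_apply, hf, hf']
  | of i f =>
    induction g using DirectSum.induction_on with
    | zero => simp
    | add g g' hg hg' => simp only [map_add, AddMonoidHom.add_apply, hg, hg']
    | of j g =>
      induction h using DirectSum.induction_on with
      | zero => simp
      | add h h' hh hh' => simp only [map_add, hh, hh']
      | of k h =>
        rw [compHom_of_of (rfl : j + i = j + i), compHom_of_of (rfl : k + j = k + j),
          compHom_of_of (rfl : k + (j + i) = k + (j + i)),
          compHom_of_of (add_assoc k j i), ShiftedHom.comp_assoc f g h rfl rfl (add_assoc k j i)]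

instance : Category.{v} (OrbitCat C) where
  Hom X Y := Hom X.as Y.as
  id X := DirectSum.of (fun n : ℤ => ShiftedHom X.as X.as n) 0 (ShiftedHom.mk₀ 0 rfl (𝟙 X.as))
  comp {X Y Z} f g := compHom X.as Y.as Z.as f g
  id_comp f := id_compHom f
  comp_id f := compHom_id f
  assoc f g h := compHom_assoc f g h

end OrbitCat

/-! ### The bounded derived category of the integers -/

/-- The standard construction of the derived category, as a localization. -/
instance : HasDerivedCategory.{1} (FGModuleCat.{0} ℤ) := HasDerivedCategory.standard _

/-- The bounded derived category `D^b(ℤ)` of the category of finitely generated abelian groups. -/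
abbrev DbInt : Type 1 := DerivedCategory.Bounded (FGModuleCat.{0} ℤ)

end

/-! Every category is compared with the homotopy category (d).

(c) and (d): let `C` be a hereditary abelian category with enough projectives, such as the finitely
generated abelian groups. Both sides arise from one auxiliary category `TwoTerm C`, whose objects
are monomorphisms `X₁ ⟶ X₀` of projectives and whose morphisms are chain maps together with an
arbitrary `s : X₁ ⟶ Y₀`. Folding such an object gives a perfect structure on `X₁ ⊞ X₀`, and every
perfect `(N, d)` has this form because `N ≅ im d ⊞ ker d`. Its cokernel, placed in degree zero,
gives an object of the orbit category; morphisms between such objects live in `Hom ⊕ Ext¹`, and `s`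
represents the `Ext¹` part. Up to isomorphism every object arises: a bounded complex is the sum of
its shifted cohomology objects, and the orbit category identifies shifts. Both functors are full,
and by `TwoTerm.toHomotopyCat_map_eq_iff` and `TwoTerm.toOrbitCat_map_eq_iff` each identifies
exactly the `Homotopic` pairs, so the targets are equivalent.

(d) and (e): null-homotopic maps factor through free structures on projectives, which are
projective, and projective structures are contractible. Hence the two relations coincide
(`DiffStr.stableRel_isPerfect`).

(b) and (d): a `ℤ[ε]`-module is an abelian group with a differential, and torsionless means
projective over `ℤ` (`DualNumber.isTorsionless_iff`).

(a) and (b): the two classes of modules are equal. A kernel inside a projective is torsionless;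
conversely `ℤ[ε] ⊗ M` in every degree, with alternating differentials, is a complete resolution of a
torsionless `M`. -/

noncomputable section

universe w v u

open Limits DerivedCategory Pretriangulated DualNumber

open scoped ZeroObject

/-! ### Equivalences obtained by comparing quotients of a common category. -/

namespace CategoryTheory

/-- A full and essentially surjective functor is an equivalence modulo its kernel. -/
theorem isEquivalence_lift_homRel {T X Y : Type*} [Category* T] [Category* X] [Category* Y]
    (F : T ⥤ X) (G : T ⥤ Y) [G.Full] [G.EssSurj]
    (h : ∀ {A B : T} (f g : A ⟶ B), F.map f = F.map g ↔ G.map f = G.map g) :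
    (Quotient.lift F.homRel G (fun _ _ _ _ e => (h _ _).1 e)).IsEquivalence where
  faithful := ⟨by
    rintro ⟨A⟩ ⟨B⟩ f g e
    obtain ⟨f, rfl⟩ := (Quotient.functor F.homRel).map_surjective f
    obtain ⟨g, rfl⟩ := (Quotient.functor F.homRel).map_surjective g
    exact Quotient.sound _ ((h f g).2 e)⟩
  full := ⟨by
    rintro ⟨A⟩ ⟨B⟩ f
    obtain ⟨f, rfl⟩ := G.map_surjective f
    exact ⟨(Quotient.functor F.homRel).map f, rfl⟩⟩
  essSurj := ⟨fun Y => ⟨⟨G.objPreimage Y⟩, ⟨G.objObjPreimageIso Y⟩⟩⟩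

/-- If two full and essentially surjective functors identify the same pairs of morphisms, then
their targets are equivalent. -/
theorem nonempty_equivalence_of_full {T X Y : Type*} [Category* T] [Category* X] [Category* Y]
    (F : T ⥤ X) (G : T ⥤ Y) [F.Full] [F.EssSurj] [G.Full] [G.EssSurj]
    (h : ∀ {A B : T} (f g : A ⟶ B), F.map f = F.map g ↔ G.map f = G.map g) :
    Nonempty (X ≌ Y) := by
  have := isEquivalence_lift_homRel F F (fun _ _ => Iff.rfl)
  have := isEquivalence_lift_homRel F G h
  exact ⟨(Quotient.lift F.homRel F _).asEquivalence.symm.trans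
    (Quotient.lift F.homRel G _).asEquivalence⟩

end CategoryTheory

/-! ### Differential structures: homotopy versus factoring through projectives. -/

namespace DiffStr

variable {C : Type u} [Category.{v} C] [Preadditive C]

@[simp] lemma sub_f {X Y : DiffStr C} (g h : X ⟶ Y) : (g - h).f = g.f - h.f := by
  rw [sub_eq_add_neg, sub_eq_add_neg, add_f, neg_f]

lemma comm' {X Y : DiffStr C} (g : X ⟶ Y) : g.f ≫ Y.d = X.d ≫ g.f := Hom.comm g

lemma comm'_assoc {X Y : DiffStr C} (g : X ⟶ Y) {Z : C} (h : Y.obj ⟶ Z) :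
    g.f ≫ Y.d ≫ h = X.d ≫ g.f ≫ h := by
  rw [← Category.assoc, comm' g, Category.assoc]

/-- An isomorphism of the underlying objects commuting with the differentials. -/
@[simps]
def isoMk {X Y : DiffStr C} (e : X.obj ≅ Y.obj) (h : e.hom ≫ Y.d = X.d ≫ e.hom) : X ≅ Y where
  hom := ⟨e.hom, h⟩
  inv := ⟨e.inv, by rw [Iso.inv_comp_eq, ← Category.assoc, h, Category.assoc, e.hom_inv_id,
    Category.comp_id]⟩
  hom_inv_id := hom_ext e.hom_inv_id
  inv_hom_id := hom_ext e.inv_hom_id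

instance congruence_homotopyRel : Congruence (homotopyRel C) where
  equivalence :=
    { refl := fun f => ⟨0, by simp⟩
      symm := by
        rintro f g ⟨h, e⟩
        exact ⟨-h, by rw [← neg_sub, e]; simp [add_comm]⟩
      trans := by
        rintro f g k ⟨h, e⟩ ⟨h', e'⟩
        refine ⟨h + h', ?_⟩
        rw [← sub_add_sub_cancel, e, e']
        simp only [Preadditive.comp_add, Preadditive.add_comp]
        abel }
  comp_left := by
    rintro X Y Z f g g' ⟨h, e⟩
    refine ⟨f.hom.f ≫ h, ?_⟩
    change f.hom.f ≫ g.hom.f - f.hom.f ≫ g'.hom.f = _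
    rw [← Preadditive.comp_sub, e, Preadditive.comp_add, comm'_assoc, Category.assoc]
  comp_right := by
    rintro X Y Z f f' g ⟨h, e⟩
    refine ⟨h ≫ g.hom.f, ?_⟩
    change f.hom.f ≫ g.hom.f - f'.hom.f ≫ g.hom.f = _
    rw [← Preadditive.sub_comp, e, Preadditive.add_comp, Category.assoc, Category.assoc,
      Category.assoc, comm']

variable [HasBinaryBiproducts C]

/-- The contractible differential structure on `P ⊞ P`, freely generated by `P`. -/
abbrev free (P : C) : DiffStr C where
  obj := P ⊞ P
  d := biprod.fst ≫ biprod.inr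
  d_d := by simp

/-- The morphism from a free differential structure extending a given morphism. -/
@[simps]
def freeDesc {P : C} {Y : DiffStr C} (h : P ⟶ Y.obj) : free P ⟶ Y :=
  ⟨biprod.desc h (h ≫ Y.d), by ext <;> simp [Y.d_d]⟩

/-- The morphism to a free differential structure lifting a given morphism. -/
@[simps]
def freeLift {P : C} {X : DiffStr C} (h : X.obj ⟶ P) : X ⟶ free P :=
  ⟨biprod.lift (X.d ≫ h) h, by ext <;> simp [reassoc_of% X.d_d]⟩

/-- Turns a homotopy into a factorization: with `a = 𝟙` and `b = h`, the map `d h + h d` passes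
through `free X.obj`. -/
lemma freeLift_freeDesc {P : C} {X Y : DiffStr C} (a : X.obj ⟶ P) (b : P ⟶ Y.obj) :
    (freeLift a ≫ freeDesc b).f = X.d ≫ a ≫ b + (a ≫ b) ≫ Y.d := by
  simp

lemma freeDesc_inl {P : C} {Y : DiffStr C} (g : free P ⟶ Y) :
    freeDesc (biprod.inl ≫ g.f) = g := by
  have := comm' g
  ext
  · simp
  · simp [this]

/-- The structure `free` is also cofree, so forgetting the differential is a left adjoint and
preserves epimorphisms: a pair `a`, `b` is tested after `freeLift` and recovered as the second
component. -/
lemma epi_f {X Y : DiffStr C} (g : X ⟶ Y) [Epi g] : Epi g.f := by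
  refine ⟨fun {Z} a b e => ?_⟩
  have : g ≫ freeLift a = g ≫ freeLift b := by
    ext
    · simp [comm'_assoc, e]
    · simp [e]
  simpa using congrArg (fun t => t.f ≫ biprod.snd) ((cancel_epi g).1 this)

instance projective_free (P : C) [Projective P] : Projective (free P) where
  factors {E X} f e _ := by
    have := epi_f e
    refine ⟨freeDesc (Projective.factorThru (biprod.inl ≫ f.f) e.f), ?_⟩
    rw [← freeDesc_inl f]
    ext
    · simp
    · simp [← comm' e]

/-- A projective `Q` is a retract of the contractible structure `free Q.obj`; the contraction is
read off from a section. -/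
lemma exists_contraction (Q : DiffStr C) [Projective Q] :
    ∃ h : Q.obj ⟶ Q.obj, 𝟙 Q.obj = Q.d ≫ h + h ≫ Q.d := by
  have : Epi (freeDesc (𝟙 Q.obj)) := ⟨fun a b e => by
    ext
    simpa only [comp_f, freeDesc_f, biprod.inl_desc_assoc, Category.id_comp] using
      congrArg (fun t => biprod.inl ≫ t.f) e⟩
  obtain ⟨s, hs⟩ := Projective.factors (𝟙 Q) (freeDesc (𝟙 Q.obj))
  refine ⟨s.f ≫ biprod.snd, ?_⟩
  -- Write `s = (s₁, s₂)`. Compatibility with the differentials gives `s₁ = d s₂`, and being a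
  -- section gives `𝟙 = s₁ + s₂ d`.
  have h₁ := congrArg (fun t => t ≫ biprod.snd) (comm' s)
  have h₂ := congrArg Hom.f hs
  simp only [Category.assoc, biprod.inr_snd, Category.comp_id, comp_f, freeDesc_f,
    Category.id_comp, id_f, biprod.desc_eq,
    Preadditive.comp_add] at h₁ h₂
  rw [← h₁, ← h₂, Category.assoc]

theorem stableRel_isPerfect : stableRel (IsPerfect C) = homotopyRel C := by
  funext X Y f g
  refine propext ⟨?_, ?_⟩
  · rintro ⟨Q, hQ, a, b, e⟩
    obtain ⟨h, eh⟩ := exists_contraction Q.obj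
    refine ⟨a.hom.f ≫ h ≫ b.hom.f, ?_⟩
    have e' : f.hom.f - g.hom.f = a.hom.f ≫ b.hom.f := by
      rw [← sub_f]
      exact congrArg (fun t => t.hom.f) e
    have e'' : f.hom.f - g.hom.f = a.hom.f ≫ (Q.obj.d ≫ h + h ≫ Q.obj.d) ≫ b.hom.f := by
      rw [e', ← eh, Category.id_comp]
    rw [e'', Preadditive.add_comp, Preadditive.comp_add, Category.assoc, Category.assoc,
      comm'_assoc, ← comm' b.hom, Category.assoc, Category.assoc]
  · rintro ⟨h, e⟩
    have := X.property
    dsimp [IsPerfect] at this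
    refine ⟨⟨free X.obj.obj, show Projective (X.obj.obj ⊞ X.obj.obj) from inferInstance⟩,
      projective_free _, ⟨freeLift (𝟙 _)⟩, ⟨freeDesc h⟩, ?_⟩
    apply ObjectProperty.hom_ext
    ext
    change (f.hom - g.hom).f = (freeLift (𝟙 _) ≫ freeDesc h).f
    rw [freeLift_freeDesc, sub_f, e, Category.id_comp]

theorem nonempty_homotopyCat_equivalence_stableCat :
    Nonempty (HomotopyCat C ≌ StableCat (IsPerfect C)) := by
  unfold StableCat
  rw [stableRel_isPerfect]
  exact ⟨CategoryTheory.Equivalence.refl⟩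

end DiffStr

/-! ### Two-term resolutions and the folding functor to perfect differential structures. -/

/-- An abelian category in which subobjects of projective objects are projective. -/
class IsHereditary (C : Type u) [Category.{v} C] : Prop where
  projective_of_mono {X Y : C} (f : X ⟶ Y) [Mono f] [Projective Y] : Projective X

/-- A monomorphism between projective objects, seen as a two-term projective resolution. -/
structure TwoTerm (C : Type u) [Category.{v} C] where
  /-- the object of syzygies -/
  X₁ : C
  /-- the object of generators -/
  X₀ : C
  /-- the monomorphism -/
  d : X₁ ⟶ X₀
  [mono_d : Mono d]
  [projective_X₁ : Projective X₁]
  [projective_X₀ : Projective X₀]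

namespace TwoTerm

attribute [instance] mono_d projective_X₁ projective_X₀

variable {C : Type u} [Category.{v} C] [Preadditive C]

/-- A morphism of degree zero together with a morphism of degree one. -/
@[ext]
structure Hom (X Y : TwoTerm C) where
  /-- the morphism between syzygies -/
  f₁ : X.X₁ ⟶ Y.X₁
  /-- the morphism between generators -/
  f₀ : X.X₀ ⟶ Y.X₀
  /-- the component of degree one -/
  s : X.X₁ ⟶ Y.X₀
  comm : f₁ ≫ Y.d = X.d ≫ f₀

@[simps]
instance : Category.{v} (TwoTerm C) where
  Hom X Y := Hom X Y
  id X := ⟨𝟙 _, 𝟙 _, 0, by simp⟩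
  comp f g := ⟨f.f₁ ≫ g.f₁, f.f₀ ≫ g.f₀, f.f₁ ≫ g.s + f.s ≫ g.f₀, by
    rw [Category.assoc, g.comm, reassoc_of% f.comm]⟩
  id_comp f := by ext <;> simp
  comp_id f := by ext <;> simp
  assoc f g h := by ext <;> simp [add_assoc]

/-- Homotopies between morphisms of two-term resolutions. -/
def Homotopic {X Y : TwoTerm C} (f g : X ⟶ Y) : Prop :=
  ∃ (h : X.X₀ ⟶ Y.X₁) (k : X.X₀ ⟶ Y.X₀) (l : X.X₁ ⟶ Y.X₁),
    f.f₀ - g.f₀ = h ≫ Y.d ∧ f.f₁ - g.f₁ = X.d ≫ h ∧ f.s - g.s = X.d ≫ k + l ≫ Y.d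

variable [HasBinaryBiproducts C]

/-- The differential structure on the total object of a two-term resolution. -/
abbrev total (X : TwoTerm C) : DiffStr C where
  obj := X.X₁ ⊞ X.X₀
  d := biprod.fst ≫ X.d ≫ biprod.inr
  d_d := by simp

/-- The morphism induced on total objects. -/
abbrev totalMap {X Y : TwoTerm C} (f : X ⟶ Y) : total X ⟶ total Y where
  f := biprod.desc (biprod.lift f.f₁ f.s) (f.f₀ ≫ biprod.inr)
  comm := by ext <;> simp [f.comm]

variable (C) in
/-- The functor sending a two-term resolution to its total differential structure. -/
@[simps]
def totalFunctor : TwoTerm C ⥤ (DiffStr.IsPerfect C).FullSubcategory where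
  obj X := ⟨total X, show Projective (X.X₁ ⊞ X.X₀) from inferInstance⟩
  map f := ⟨totalMap f⟩
  map_id X := by
    apply ObjectProperty.hom_ext
    apply DiffStr.hom_ext
    change biprod.desc (biprod.lift (𝟙 _) 0) (𝟙 _ ≫ biprod.inr) = 𝟙 _
    ext <;> simp
  map_comp f g := by
    apply ObjectProperty.hom_ext
    apply DiffStr.hom_ext
    change biprod.desc (biprod.lift (f.f₁ ≫ g.f₁) (f.f₁ ≫ g.s + f.s ≫ g.f₀))
      ((f.f₀ ≫ g.f₀) ≫ biprod.inr) = biprod.desc (biprod.lift f.f₁ f.s) (f.f₀ ≫ biprod.inr) ≫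
        biprod.desc (biprod.lift g.f₁ g.s) (g.f₀ ≫ biprod.inr)
    ext <;> simp

/-- A map of total structures is a 2×2 matrix. The entry `X₀ ⟶ Y₁` must vanish, because the
differential kills `X₀` while `Y.d` is mono; the three remaining entries are the data of a morphism.
-/
instance : (totalFunctor C).Full where
  map_surjective {X Y} := by
    rintro ⟨⟨f, hf⟩⟩
    change X.X₁ ⊞ X.X₀ ⟶ Y.X₁ ⊞ Y.X₀ at f
    change f ≫ biprod.fst ≫ Y.d ≫ biprod.inr = (biprod.fst ≫ X.d ≫ biprod.inr) ≫ f at hf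
    have h₀ : biprod.inr ≫ f ≫ biprod.fst = 0 := by
      rw [← cancel_mono Y.d]
      simpa using congrArg (fun t => biprod.inr ≫ t ≫ biprod.snd) hf
    have h₁ : biprod.inl ≫ f ≫ biprod.fst ≫ Y.d = X.d ≫ biprod.inr ≫ f ≫ biprod.snd := by
      simpa using congrArg (fun t => biprod.inl ≫ t ≫ biprod.snd) hf
    refine ⟨⟨biprod.inl ≫ f ≫ biprod.fst, biprod.inr ≫ f ≫ biprod.snd,
      biprod.inl ≫ f ≫ biprod.snd, by simpa using h₁⟩, ?_⟩
    apply ObjectProperty.hom_ext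
    apply DiffStr.hom_ext
    change biprod.desc (biprod.lift (biprod.inl ≫ f ≫ biprod.fst) (biprod.inl ≫ f ≫ biprod.snd))
      ((biprod.inr ≫ f ≫ biprod.snd) ≫ biprod.inr) = f
    ext <;> simp [h₀]

/-- In `d t + t d` the entry `X₁ ⟶ Y₀` of `t` never appears; the other three entries are `h`, `k`,
`l`. -/
lemma homotopyRel_totalFunctor_map_iff {X Y : TwoTerm C} (f g : X ⟶ Y) :
    DiffStr.homotopyRel C ((totalFunctor C).map f) ((totalFunctor C).map g) ↔ Homotopic f g := by
  have key (t : X.X₁ ⊞ X.X₀ ⟶ Y.X₁ ⊞ Y.X₀) :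
      biprod.desc (biprod.lift f.f₁ f.s) (f.f₀ ≫ biprod.inr) -
        biprod.desc (biprod.lift g.f₁ g.s) (g.f₀ ≫ biprod.inr) =
        (biprod.fst ≫ X.d ≫ biprod.inr) ≫ t + t ≫ biprod.fst ≫ Y.d ≫ biprod.inr ↔
      (f.f₀ - g.f₀ = (biprod.inr ≫ t ≫ biprod.fst) ≫ Y.d ∧
        f.f₁ - g.f₁ = X.d ≫ biprod.inr ≫ t ≫ biprod.fst ∧
        f.s - g.s = X.d ≫ (biprod.inr ≫ t ≫ biprod.snd) +
          (biprod.inl ≫ t ≫ biprod.fst) ≫ Y.d) := by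
    constructor
    · intro e
      refine ⟨?_, ?_, ?_⟩
      · simpa using congrArg (fun t => biprod.inr ≫ t ≫ biprod.snd) e
      · simpa using congrArg (fun t => biprod.inl ≫ t ≫ biprod.fst) e
      · simpa using congrArg (fun t => biprod.inl ≫ t ≫ biprod.snd) e
    · rintro ⟨e₀, e₁, e⟩
      ext
      · simpa using e₁
      · simpa using e
      · simp
      · simpa using e₀
  constructor
  · rintro ⟨t, e⟩
    exact ⟨_, _, _, (key t).1 e⟩
  · rintro ⟨h, k, l, e⟩
    let t : X.X₁ ⊞ X.X₀ ⟶ Y.X₁ ⊞ Y.X₀ := biprod.desc (l ≫ biprod.inl) (biprod.lift h k)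
    have h₁ : biprod.inr ≫ t ≫ biprod.fst = h := by simp [t]
    have h₂ : biprod.inr ≫ t ≫ biprod.snd = k := by simp [t]
    have h₃ : biprod.inl ≫ t ≫ biprod.fst = l := by simp [t]
    exact ⟨t, (key t).2 (by rwa [h₁, h₂, h₃])⟩

variable (C) in
/-- The functor from two-term resolutions to the homotopy category of perfect differential
structures. -/
abbrev toHomotopyCat : TwoTerm C ⥤ DiffStr.HomotopyCat C :=
  totalFunctor C ⋙ Quotient.functor _

lemma toHomotopyCat_map_eq_iff {X Y : TwoTerm C} (f g : X ⟶ Y) :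
    (toHomotopyCat C).map f = (toHomotopyCat C).map g ↔ Homotopic f g :=
  (Quotient.functor_map_eq_iff _ _ _).trans (homotopyRel_totalFunctor_map_iff f g)

end TwoTerm

namespace TwoTerm

variable {C : Type u} [Category.{v} C] [Abelian C] [IsHereditary C]

/-- By heredity the image of `d` is projective, so `N ⟶ im d` splits and `N ≅ im d ⊞ ker d`. In
these coordinates `d` is the inclusion `im d ⟶ ker d`. -/
lemma exists_iso_total (N : DiffStr C) [Projective N.obj] :
    ∃ X : TwoTerm C, Nonempty (total X ≅ N) := by
  let i := image.ι N.d
  let p := factorThruImage N.d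
  have hpi : p ≫ i = N.d := image.fac N.d
  have hip : i ≫ N.d = 0 := by
    rw [← cancel_epi p, reassoc_of% hpi, N.d_d, comp_zero]
  have : Projective (image N.d) := IsHereditary.projective_of_mono i
  have : Projective (kernel N.d) := IsHereditary.projective_of_mono (kernel.ι N.d)
  let s : image N.d ⟶ N.obj := Projective.factorThru (𝟙 _) p
  have hs : s ≫ p = 𝟙 _ := Projective.factorThru_comp _ _
  have hsd : s ≫ N.d = i := (congrArg (s ≫ ·) hpi.symm).trans (by simp [reassoc_of% hs])
  let d : image N.d ⟶ kernel N.d := kernel.lift N.d i hip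
  have hd : d ≫ kernel.ι N.d = i := kernel.lift_ι _ _ _
  have : Mono d := mono_of_mono_fac hd
  have hr : (𝟙 N.obj - p ≫ s) ≫ N.d = 0 := by
    rw [Preadditive.sub_comp, Category.assoc, hsd, hpi, Category.id_comp, sub_self]
  have hkp : kernel.ι N.d ≫ p = 0 := by
    rw [← cancel_mono i, Category.assoc, hpi, kernel.condition, zero_comp]
  refine ⟨⟨_, _, d⟩, ⟨DiffStr.isoMk ⟨biprod.desc s (kernel.ι N.d),
    biprod.lift p (kernel.lift N.d _ hr), ?_, ?_⟩ ?_⟩⟩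
  · ext <;> simp [hs, hkp, reassoc_of% hs, reassoc_of% hkp]
  · simp
  · ext <;> simp [hsd, hd]

instance : (toHomotopyCat C).EssSurj where
  mem_essImage := by
    rintro ⟨⟨N, hN⟩⟩
    have : Projective N.obj := hN
    obtain ⟨X, ⟨e⟩⟩ := exists_iso_total N
    exact ⟨X, ⟨(Quotient.functor _).mapIso (ObjectProperty.isoMk _ e)⟩⟩

end TwoTerm

/-! ### Orbit categories: additivity, isomorphic shifts, functoriality. -/

namespace OrbitCat

section

variable {C : Type u} [Category.{v} C] [Preadditive C] [HasShift C ℤ]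
variable {D : Type*} [Category* D] [Preadditive D] [HasShift D ℤ] (F : C ⥤ D) [F.Additive]
  [F.CommShift ℤ]

/-- The action on homogeneous morphisms of a functor commuting with shifts. -/
@[simps!]
def mapShifted (X Y : C) (i : ℤ) : ShiftedHom X Y i →+ ShiftedHom (F.obj X) (F.obj Y) i :=
  AddMonoidHom.mk' (fun f => f.map F) (fun f g => ShiftedHom.map_add f g F)

/-- The action on morphisms of orbit categories of a functor commuting with shifts. -/
def mapHom (X Y : C) : Hom X Y →+ Hom (F.obj X) (F.obj Y) :=
  DirectSum.map (mapShifted F X Y)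

lemma mapHom_of (X Y : C) (i : ℤ) (f : ShiftedHom X Y i) :
    mapHom F X Y (DirectSum.of (fun n : ℤ => ShiftedHom X Y n) i f) =
      DirectSum.of (fun n : ℤ => ShiftedHom (F.obj X) (F.obj Y) n) i (f.map F) :=
  DirectSum.map_of _ _ _

lemma mapShifted_bijective [F.Full] [F.Faithful] (X Y : C) (i : ℤ) :
    Function.Bijective (mapShifted F X Y i) := by
  constructor
  · intro f g h
    exact F.map_injective ((cancel_mono ((F.commShiftIso i).hom.app Y)).1 h)
  · intro g
    obtain ⟨f, hf⟩ := F.map_surjective (g ≫ (F.commShiftIso i).inv.app Y)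
    exact ⟨f, by simp [ShiftedHom.map, hf]⟩

end

variable {C : Type u} [Category.{v} C] [Preadditive C] [HasShift C ℤ]
  [∀ i : ℤ, (shiftFunctor C i).Additive]

/-- The homogeneous morphism of degree `i` of the orbit category given by `X ⟶ Y⟦i⟧`. -/
def homOf {X Y : C} (i : ℤ) (f : ShiftedHom X Y i) : (⟨X⟩ : OrbitCat C) ⟶ ⟨Y⟩ :=
  DirectSum.of (fun n : ℤ => ShiftedHom X Y n) i f

instance (X Y : OrbitCat C) : AddCommGroup (X ⟶ Y) :=
  inferInstanceAs (AddCommGroup (Hom X.as Y.as))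

instance : Preadditive (OrbitCat C) where
  add_comp X Y Z f g h := by
    change compHom _ _ _ (f + g) h = _
    rw [map_add]
    rfl
  comp_add X Y Z f g h := by
    change compHom _ _ _ f (g + h) = _
    rw [map_add]
    rfl

lemma homOf_comp_homOf {X Y Z : C} {i j k : ℤ} (f : ShiftedHom X Y i) (g : ShiftedHom Y Z j)
    (h : j + i = k) : homOf i f ≫ homOf j g = homOf k (f.comp g h) :=
  compHom_of_of h f g

lemma homOf_add {X Y : C} (i : ℤ) (f g : ShiftedHom X Y i) :
    homOf i (f + g) = homOf i f + homOf i g :=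
  map_add (DirectSum.of (fun n : ℤ => ShiftedHom X Y n) i) f g

lemma homOf_zero {X Y : C} (i : ℤ) : homOf i (0 : ShiftedHom X Y i) = 0 :=
  map_zero (DirectSum.of (fun n : ℤ => ShiftedHom X Y n) i)

lemma homOf_add_homOf_eq_iff {X Y : C} {i j : ℤ} (hij : i ≠ j) (f f' : ShiftedHom X Y i)
    (g g' : ShiftedHom X Y j) :
    homOf i f + homOf j g = homOf i f' + homOf j g' ↔ f = f' ∧ g = g' := by
  refine ⟨fun e => ?_, fun ⟨e, e'⟩ => by rw [e, e']⟩
  have h (n : ℤ) := congrArg (fun t : Hom X Y => t n) e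
  dsimp only [homOf] at h
  have hi := h i
  have hj := h j
  erw [DirectSum.add_apply, DirectSum.add_apply] at hi hj
  rw [DirectSum.of_eq_same, DirectSum.of_eq_same, DirectSum.of_eq_of_ne _ _ _ hij,
    DirectSum.of_eq_of_ne _ _ _ hij, add_zero, add_zero] at hi
  rw [DirectSum.of_eq_same, DirectSum.of_eq_same, DirectSum.of_eq_of_ne _ _ _ hij.symm,
    DirectSum.of_eq_of_ne _ _ _ hij.symm, zero_add, zero_add] at hj
  exact ⟨hi, hj⟩

/-- A morphism of the orbit category is a sum of two homogeneous ones if the other components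
vanish. -/
lemma exists_eq_homOf_add_homOf {X Y : C} {i j : ℤ} (hij : i ≠ j)
    (h : ∀ n, n ≠ i → n ≠ j → ∀ f : ShiftedHom X Y n, f = 0)
    (φ : (⟨X⟩ : OrbitCat C) ⟶ ⟨Y⟩) : ∃ f g, φ = homOf i f + homOf j g := by
  change Hom X Y at φ
  refine ⟨φ i, φ j, ?_⟩
  refine DFinsupp.ext fun n => ?_
  change φ n = (DirectSum.of _ i (φ i) + DirectSum.of _ j (φ j) : Hom X Y) n
  rw [DirectSum.add_apply]
  by_cases hi : n = i
  · subst hi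
    rw [DirectSum.of_eq_same, DirectSum.of_eq_of_ne _ _ _ hij, add_zero]
  · by_cases hj : n = j
    · subst hj
      rw [DirectSum.of_eq_same, DirectSum.of_eq_of_ne _ _ _ hij.symm, zero_add]
    · rw [h n hi hj (φ n), DirectSum.of_eq_of_ne _ _ _ hi, DirectSum.of_eq_of_ne _ _ _ hj,
        add_zero]

variable (C) in
/-- The projection functor to the orbit category. -/
@[simps]
def proj : C ⥤ OrbitCat C where
  obj X := ⟨X⟩
  map f := homOf 0 (ShiftedHom.mk₀ 0 rfl f)
  map_id _ := rfl
  map_comp f g := by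
    rw [homOf_comp_homOf _ _ (add_zero 0), ShiftedHom.mk₀_comp_mk₀]

instance : (proj C).Additive where
  map_add {X Y f g} := by
    dsimp only [proj]
    rw [ShiftedHom.mk₀_add, homOf_add]
    rfl

/-- The projection to the orbit category identifies an object with its shifts. -/
lemma nonempty_iso_of_iso_shift {X Y : C} {i : ℤ} (e : Y ≅ X⟦i⟧) :
    Nonempty ((proj C).obj Y ≅ (proj C).obj X) := by
  have inj {W : C} {j k : ℤ} (h : i + j = k) (a b : ShiftedHom W Y j)
      (hab : a.comp (c := k) e.hom h = b.comp e.hom h) : a = b := by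
    rw [← cancel_mono (e.hom⟦j⟧'), ← cancel_mono ((shiftFunctorAdd' C i j k h).inv.app X)]
    simpa [ShiftedHom.comp] using hab
  let α : ShiftedHom X Y (-i) :=
    (ShiftedHom.mk₀ 0 rfl (𝟙 X) : ShiftedHom X X (0 : ℤ)) ≫
      (shiftFunctorAdd' C i (-i) 0 (by simp)).hom.app X ≫ e.inv⟦-i⟧'
  have h₁ : α.comp (c := 0) e.hom (by simp) = ShiftedHom.mk₀ 0 rfl (𝟙 X) := by
    simp [α, ShiftedHom.comp, ← Functor.map_comp_assoc]
  have h₂ : ShiftedHom.comp (c := 0) (e.hom : ShiftedHom Y X i) α (by simp) =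
      ShiftedHom.mk₀ 0 rfl (𝟙 Y) := by
    -- Since `α` followed by `e` is the identity, `e α e = e`, and the last `e` can be cancelled.
    apply inj (add_zero i)
    rw [ShiftedHom.mk₀_id_comp, ShiftedHom.comp_assoc (a₁ := i) (a₂ := -i) (a₃ := i)
      (a₁₂ := 0) (a₂₃ := 0) _ _ _ (by simp) (by simp) (by simp), h₁, ShiftedHom.comp_mk₀_id]
  refine ⟨⟨homOf i e.hom, homOf (-i) α, ?_, ?_⟩⟩
  · exact (homOf_comp_homOf _ _ (by simp)).trans (congrArg (homOf 0) h₂)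
  · exact (homOf_comp_homOf _ _ (by simp)).trans (congrArg (homOf 0) h₁)

variable {D : Type*} [Category* D] [Preadditive D] [HasShift D ℤ]
  [∀ i : ℤ, (shiftFunctor D i).Additive] (F : C ⥤ D) [F.Additive] [F.CommShift ℤ]

/-- The functor between orbit categories induced by a functor commuting with shifts. -/
@[simps]
def mapFunctor : OrbitCat C ⥤ OrbitCat D where
  obj X := ⟨F.obj X.as⟩
  map {X Y} f := mapHom F X.as Y.as f
  map_id X := by
    change mapHom F _ _ (DirectSum.of _ 0 _) = DirectSum.of _ 0 _
    rw [mapHom_of, ShiftedHom.map_mk₀, F.map_id]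
  map_comp {X Y Z} f g := by
    change mapHom F _ _ (compHom _ _ _ f g) = compHom _ _ _ (mapHom F _ _ f) (mapHom F _ _ g)
    induction f using DirectSum.induction_on with
    | zero => simp
    | add f f' hf hf' => simp only [map_add, AddMonoidHom.add_apply, hf, hf']
    | of i f =>
      induction g using DirectSum.induction_on with
      | zero => simp
      | add g g' hg hg' => simp only [map_add, hg, hg']
      | of j g =>
        rw [compHom_of_of rfl, mapHom_of, mapHom_of, mapHom_of, compHom_of_of rfl,
          ShiftedHom.map_comp]

instance [F.Full] [F.Faithful] : (mapFunctor F).Faithful where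
  map_injective {X Y} :=
    (DirectSum.map_injective _).2 fun i => (mapShifted_bijective F X.as Y.as i).1

instance [F.Full] [F.Faithful] : (mapFunctor F).Full where
  map_surjective {X Y} :=
    (DirectSum.map_surjective _).2 fun i => (mapShifted_bijective F X.as Y.as i).2

end OrbitCat

/-! ### Additive functors and biproducts; comparison along essential images. -/

namespace CategoryTheory

section

variable {C D : Type*} [Category* C] [Category* D] [Preadditive C]
  [HasBinaryBiproducts C] (F : C ⥤ D) (X Y : C)

lemma Functor.map_biprod_inl_fst :
    F.map (biprod.inl : X ⟶ X ⊞ Y) ≫ F.map biprod.fst = 𝟙 _ := by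
  rw [← F.map_comp, biprod.inl_fst, F.map_id]

lemma Functor.map_biprod_inr_snd :
    F.map (biprod.inr : Y ⟶ X ⊞ Y) ≫ F.map biprod.snd = 𝟙 _ := by
  rw [← F.map_comp, biprod.inr_snd, F.map_id]

variable [Preadditive D] [F.Additive]

lemma Functor.map_biprod_inl_snd :
    F.map (biprod.inl : X ⟶ X ⊞ Y) ≫ F.map biprod.snd = 0 := by
  rw [← F.map_comp, biprod.inl_snd, F.map_zero]

lemma Functor.map_biprod_inr_fst :
    F.map (biprod.inr : Y ⟶ X ⊞ Y) ≫ F.map biprod.fst = 0 := by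
  rw [← F.map_comp, biprod.inr_fst, F.map_zero]

end

/-- An additive functor identifying `X` with `X'` and `Y` with `Y'` identifies `X ⊞ Y` with
`X' ⊞ Y'`. -/
def Functor.Additive.mapBiprodIso {C D : Type*} [Category* C] [Category* D] [Preadditive C]
    [Preadditive D] [HasBinaryBiproducts C] (F : C ⥤ D) [F.Additive] {X X' Y Y' : C}
    (e : F.obj X ≅ F.obj X') (e' : F.obj Y ≅ F.obj Y') : F.obj (X ⊞ Y) ≅ F.obj (X' ⊞ Y') where
  hom := F.map biprod.fst ≫ e.hom ≫ F.map biprod.inl +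
    F.map biprod.snd ≫ e'.hom ≫ F.map biprod.inr
  inv := F.map biprod.fst ≫ e.inv ≫ F.map biprod.inl +
    F.map biprod.snd ≫ e'.inv ≫ F.map biprod.inr
  hom_inv_id := by
    rw [← F.map_id, ← biprod.total]
    simp [reassoc_of% F.map_biprod_inl_fst, reassoc_of% F.map_biprod_inr_snd,
      reassoc_of% F.map_biprod_inl_snd, reassoc_of% F.map_biprod_inr_fst, -biprod.total]
  inv_hom_id := by
    rw [← F.map_id, ← biprod.total]
    simp [reassoc_of% F.map_biprod_inl_fst, reassoc_of% F.map_biprod_inr_snd,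
      reassoc_of% F.map_biprod_inl_snd, reassoc_of% F.map_biprod_inr_fst, -biprod.total]

/-- Two full functors that identify the same pairs of morphisms, the first one essentially
surjective and the second one with the essential image of a fully faithful functor. -/
theorem nonempty_equivalence_of_full_of_essImage {T X Y Z : Type*} [Category* T] [Category* X]
    [Category* Y] [Category* Z] (F : T ⥤ X) (G : T ⥤ Z) (H : Y ⥤ Z) [F.Full] [F.EssSurj]
    [G.Full] [H.Full] [H.Faithful] (hG : ∀ t, H.essImage (G.obj t))
    (hH : ∀ y, G.essImage (H.obj y))
    (h : ∀ {A B : T} (f g : A ⟶ B), F.map f = F.map g ↔ G.map f = G.map g) :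
    Nonempty (X ≌ Y) := by
  let G' : T ⥤ H.EssImageSubcategory := H.essImage.lift G hG
  have : G'.EssSurj := ⟨by
    rintro ⟨z, y, ⟨e⟩⟩
    obtain ⟨t, ⟨e'⟩⟩ := hH y
    exact ⟨t, ⟨ObjectProperty.isoMk _ (e' ≪≫ e)⟩⟩⟩
  obtain ⟨e⟩ := nonempty_equivalence_of_full F G' (fun f g => (h f g).trans
    ⟨fun e => ObjectProperty.hom_ext _ e, fun e => congrArg (fun t => t.hom) e⟩)
  exact ⟨e.trans H.toEssImage.asEquivalence.symm⟩

end CategoryTheory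

/-! ### From two-term resolutions to the orbit category of the derived category. -/

namespace DerivedCategory

variable {C : Type u} [Category.{v} C] [Abelian C] [HasDerivedCategory.{w} C]

lemma from_singleFunctor_obj_eq_zero_of_isLE_of_projective {P : C} [Projective P]
    {W : DerivedCategory C} (n : ℤ) (hn : n < 0) [W.IsLE n]
    (f : (singleFunctor C 0).obj P ⟶ W) : f = 0 := by
  obtain ⟨K, _, ⟨e⟩⟩ := exists_iso_Q_obj_of_isLE W n
  rw [← cancel_mono e.hom, zero_comp]
  exact from_singleFunctor_obj_eq_zero_of_projective _ n hn

end DerivedCategory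

namespace TwoTerm

section

variable {C : Type u} [Category.{v} C] [Abelian C]

/-- The object resolved by a two-term resolution. -/
abbrev coker (X : TwoTerm C) : C := cokernel X.d

/-- The projection from the generators. -/
abbrev π (X : TwoTerm C) : X.X₀ ⟶ X.coker := cokernel.π X.d

/-- The morphism induced on cokernels. -/
abbrev cokerMap {X Y : TwoTerm C} (f : X ⟶ Y) : X.coker ⟶ Y.coker :=
  cokernel.map _ _ f.f₁ f.f₀ f.comm.symm

/-- A two-term resolution, as a short complex. -/
abbrev shortComplex (X : TwoTerm C) : ShortComplex C :=
  ShortComplex.mk X.d X.π (cokernel.condition _)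

lemma shortExact (X : TwoTerm C) : X.shortComplex.ShortExact where
  exact := ShortComplex.exact_of_g_is_cokernel _ (cokernelIsCokernel X.d)
  mono_f := inferInstanceAs (Mono X.d)

/-- A morphism of two-term resolutions, as a morphism of short complexes. -/
abbrev shortComplexMap {X Y : TwoTerm C} (f : X ⟶ Y) : X.shortComplex ⟶ Y.shortComplex where
  τ₁ := f.f₁
  τ₂ := f.f₀
  τ₃ := cokerMap f
  comm₁₂ := f.comm

lemma exists_of_comp_π_eq_zero (Y : TwoTerm C) {P : C} (f : P ⟶ Y.X₀)
    (hf : f ≫ Y.π = 0) : ∃ g, g ≫ Y.d = f :=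
  ⟨Y.shortExact.fIsKernel.lift (KernelFork.ofι f hf), Fork.IsLimit.lift_ι Y.shortExact.fIsKernel⟩

lemma cokerMap_surjective (X Y : TwoTerm C) (a : X.coker ⟶ Y.coker) :
    ∃ (f₀ : X.X₀ ⟶ Y.X₀) (f₁ : X.X₁ ⟶ Y.X₁), f₁ ≫ Y.d = X.d ≫ f₀ ∧ f₀ ≫ Y.π = X.π ≫ a := by
  have h : Projective.factorThru (X.π ≫ a) Y.π ≫ Y.π = X.π ≫ a := Projective.factorThru_comp _ _
  obtain ⟨f₁, h₁⟩ := exists_of_comp_π_eq_zero Y (X.d ≫ Projective.factorThru (X.π ≫ a) Y.π)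
    (by rw [Category.assoc, h, cokernel.condition_assoc, zero_comp])
  exact ⟨_, f₁, h₁, h⟩

end

variable {C : Type u} [Category.{v} C] [Abelian C] [HasDerivedCategory.{w} C]

/-- The connecting morphism of a two-term resolution in the derived category. -/
abbrev δ (X : TwoTerm C) : (singleFunctor C 0).obj X.coker ⟶
    ((singleFunctor C 0).obj X.X₁)⟦(1 : ℤ)⟧ :=
  X.shortExact.singleδ

lemma map_π_comp_δ (X : TwoTerm C) : (singleFunctor C 0).map X.π ≫ X.δ = 0 :=
  comp_distTriang_mor_zero₂₃ _ X.shortExact.singleTriangle_distinguished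

lemma δ_comp_map_d (X : TwoTerm C) : X.δ ≫ ((singleFunctor C 0).map X.d)⟦(1 : ℤ)⟧' = 0 :=
  comp_distTriang_mor_zero₃₁ _ X.shortExact.singleTriangle_distinguished

lemma δ_naturality {X Y : TwoTerm C} (f : X ⟶ Y) :
    X.δ ≫ ((singleFunctor C 0).map f.f₁)⟦(1 : ℤ)⟧' =
      (singleFunctor C 0).map (cokerMap f) ≫ Y.δ :=
  (ShortComplex.ShortExact.singleTriangle.map X.shortExact Y.shortExact (shortComplexMap f)).comm₃

lemma exists_eq_δ_comp (X : TwoTerm C) {W : DerivedCategory C}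
    (f : (singleFunctor C 0).obj X.coker ⟶ W) (hf : (singleFunctor C 0).map X.π ≫ f = 0) :
    ∃ g, f = X.δ ≫ g :=
  Triangle.yoneda_exact₃ _ X.shortExact.singleTriangle_distinguished f hf

/-- The component of degree one of the morphism of the orbit category induced by a morphism of
two-term resolutions. -/
abbrev extMap {X : TwoTerm C} {A : C} (u : X.X₁ ⟶ A) :
    ShiftedHom ((singleFunctor C 0).obj X.coker) ((singleFunctor C 0).obj A) (1 : ℤ) :=
  X.δ ≫ ((singleFunctor C 0).map u)⟦(1 : ℤ)⟧'

lemma extMap_add {X : TwoTerm C} {A : C} (u v : X.X₁ ⟶ A) :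
    extMap (u + v) = extMap u + extMap v := by
  simp [extMap, Functor.map_add]

/-- The product of two degree-one parts contains `π ≫ δ = 0`. This matches the composition in
`TwoTerm`, which has no term involving both `f.s` and `g.s`. -/
lemma extMap_comp_extMap {X Y : TwoTerm C} {A : C} (u : X.X₁ ⟶ Y.X₀) (v : Y.X₁ ⟶ A) :
    (extMap (u ≫ Y.π)).comp (extMap v) (one_add_one_eq_two : (1 : ℤ) + 1 = 2) = 0 := by
  have h : ((singleFunctor C 0).map (u ≫ Y.π))⟦(1 : ℤ)⟧' ≫ (extMap v)⟦(1 : ℤ)⟧' = 0 := by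
    rw [(singleFunctor C 0).map_comp, ← Functor.map_comp, extMap, Category.assoc,
      reassoc_of% map_π_comp_δ, zero_comp, comp_zero, Functor.map_zero]
  rw [ShiftedHom.comp, extMap, Category.assoc, reassoc_of% h, zero_comp, comp_zero]

/-- This is `Ext¹` computed from a projective resolution: `φ` vanishes on the projective `X₀`, hence
factors through `δ`. -/
lemma extMap_surjective (X : TwoTerm C) (A : C)
    (φ : (singleFunctor C 0).obj X.coker ⟶ ((singleFunctor C 0).obj A)⟦(1 : ℤ)⟧) :
    ∃ u, φ = extMap u := by
  have : (((singleFunctor C 0).obj A)⟦(1 : ℤ)⟧).IsLE (-1) := TStructure.t.isLE_shift _ 0 1 (-1)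
  obtain ⟨g, hg⟩ := exists_eq_δ_comp X φ
    (from_singleFunctor_obj_eq_zero_of_isLE_of_projective (-1) (by lia) _)
  obtain ⟨g, rfl⟩ := (shiftFunctor (DerivedCategory C) (1 : ℤ)).map_surjective g
  obtain ⟨u, rfl⟩ := (singleFunctor C 0).map_surjective g
  exact ⟨u, hg⟩

lemma extMap_eq_zero_iff {X : TwoTerm C} {A : C} (u : X.X₁ ⟶ A) :
    extMap u = 0 ↔ ∃ v, u = X.d ≫ v := by
  constructor
  · intro h
    obtain ⟨g, hg⟩ := Triangle.yoneda_exact₃ _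
      (rot_of_distTriang _ X.shortExact.singleTriangle_distinguished) _ h
    obtain ⟨g, rfl⟩ := (shiftFunctor (DerivedCategory C) (1 : ℤ)).map_surjective g
    obtain ⟨v, rfl⟩ := (singleFunctor C 0).map_surjective g
    -- Rotating the triangle replaces the shift of `X.d` by its negative.
    refine ⟨-v, ?_⟩
    apply (singleFunctor C 0).map_injective
    apply (shiftFunctor (DerivedCategory C) (1 : ℤ)).map_injective
    rw [hg]
    simp only [Functor.map_comp, Functor.map_neg, Preadditive.comp_neg]
    exact Preadditive.neg_comp _ _
  · rintro ⟨v, rfl⟩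
    rw [extMap, Functor.map_comp, Functor.map_comp, reassoc_of% δ_comp_map_d, zero_comp]

variable (C) in
/-- The functor from two-term resolutions to the orbit category of the derived category. -/
@[simps]
def toOrbitCat : TwoTerm C ⥤ OrbitCat (DerivedCategory C) where
  obj X := ⟨(singleFunctor C 0).obj X.coker⟩
  map {X Y} f := OrbitCat.homOf 0 (ShiftedHom.mk₀ 0 rfl ((singleFunctor C 0).map (cokerMap f))) +
    OrbitCat.homOf 1 (extMap (f.s ≫ Y.π))
  map_id X := by
    have h₁ : cokerMap (𝟙 X) = 𝟙 _ := by ext; simp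
    have h₂ : extMap ((Hom.s (𝟙 X) : X.X₁ ⟶ X.X₀) ≫ X.π) = 0 := by simp [extMap]
    rw [h₁, h₂, CategoryTheory.Functor.map_id, OrbitCat.homOf_zero, add_zero]
    rfl
  map_comp {X Y Z} f g := by
    have h₁ : cokerMap (f ≫ g) = cokerMap f ≫ cokerMap g := by ext; simp
    have h₂ : extMap ((Hom.s (f ≫ g) : X.X₁ ⟶ Z.X₀) ≫ Z.π) =
        (ShiftedHom.mk₀ 0 rfl ((singleFunctor C 0).map (cokerMap f))).comp (extMap (g.s ≫ Z.π))
          (add_zero 1) +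
        (extMap (f.s ≫ Y.π)).comp
          (ShiftedHom.mk₀ 0 rfl ((singleFunctor C 0).map (cokerMap g))) (zero_add 1) := by
      rw [ShiftedHom.mk₀_comp, ShiftedHom.comp_mk₀, extMap, ← reassoc_of% δ_naturality f,
        Category.assoc, ← Functor.map_comp, ← Functor.map_comp, ← Functor.map_comp, ← Functor.map_comp,
        ← extMap, ← extMap, ← extMap_add]
      simp
    rw [Preadditive.add_comp, Preadditive.comp_add, Preadditive.comp_add,
      OrbitCat.homOf_comp_homOf _ _ (add_zero 0), OrbitCat.homOf_comp_homOf _ _ (add_zero 1),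
      OrbitCat.homOf_comp_homOf _ _ (zero_add 1),
      OrbitCat.homOf_comp_homOf _ _ (one_add_one_eq_two : (1 : ℤ) + 1 = 2), extMap_comp_extMap,
      OrbitCat.homOf_zero, add_zero, ShiftedHom.mk₀_comp_mk₀, ← Functor.map_comp, h₁, h₂,
      OrbitCat.homOf_add, add_assoc]

/-- Vanishing of `Ext` beyond degree one, by dimension shifting: `f` factors through `X₁⟦1⟧`, and
shifting back leaves a map from the projective `X₁` to an object in degrees at most `n + 1 < 0`. -/
lemma from_singleFunctor_obj_coker_eq_zero (X : TwoTerm C) {W : DerivedCategory C} (n : ℤ)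
    (hn : n < -1) [W.IsLE n] (f : (singleFunctor C 0).obj X.coker ⟶ W) : f = 0 := by
  obtain ⟨g, rfl⟩ := exists_eq_δ_comp X f
    (from_singleFunctor_obj_eq_zero_of_isLE_of_projective n (by lia) _)
  have : (W⟦(-1 : ℤ)⟧).IsLE (n + 1) := TStructure.t.isLE_shift _ n (-1) (n + 1)
  have hg : (shiftFunctorCompIsoId (DerivedCategory C) (1 : ℤ) (-1) (by simp)).inv.app _ ≫
      g⟦(-1 : ℤ)⟧' = 0 :=
    from_singleFunctor_obj_eq_zero_of_isLE_of_projective (n + 1) (by lia) _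
  have hg' : g = 0 := by
    apply (shiftFunctor (DerivedCategory C) (-1 : ℤ)).map_injective
    rw [← cancel_epi ((shiftFunctorCompIsoId (DerivedCategory C) (1 : ℤ) (-1)
      (by simp)).inv.app _), hg, Functor.map_zero, comp_zero]
  rw [hg', comp_zero]

instance : (toOrbitCat C).Full where
  map_surjective {X Y} φ := by
    obtain ⟨a, b, rfl⟩ := OrbitCat.exists_eq_homOf_add_homOf (zero_ne_one (α := ℤ))
      -- Negative degrees vanish by the t-structure, degrees at least two by the length of the
      -- resolution.
      (fun n h₀ h₁ f => by
        have : (((singleFunctor C 0).obj Y.coker)⟦n⟧).IsLE (-n) :=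
          TStructure.t.isLE_shift _ 0 n (-n)
        have : (((singleFunctor C 0).obj Y.coker)⟦n⟧).IsGE (-n) :=
          TStructure.t.isGE_shift _ 0 n (-n)
        by_cases hn : n < 0
        · exact TStructure.t.zero f 0 (-n)
        · exact from_singleFunctor_obj_coker_eq_zero X (-n) (by lia) f) φ
    obtain ⟨a, rfl⟩ := (ShiftedHom.homEquiv (0 : ℤ) rfl).surjective a
    obtain ⟨a, rfl⟩ := (singleFunctor C 0).map_surjective a
    obtain ⟨u, rfl⟩ := extMap_surjective X Y.coker b
    obtain ⟨f₀, f₁, h, ha⟩ := cokerMap_surjective X Y a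
    refine ⟨⟨f₁, f₀, Projective.factorThru u Y.π, h⟩, ?_⟩
    have h₁ : cokernel.map _ _ f₁ f₀ h.symm = a := by ext; simp [ha]
    simp [h₁]
    rfl

/-- The two degrees separate: equality in degree zero is the existence of `h`, equality in degree
one that of `k` and `l`. -/
lemma toOrbitCat_map_eq_iff {X Y : TwoTerm C} (f g : X ⟶ Y) :
    (toOrbitCat C).map f = (toOrbitCat C).map g ↔ Homotopic f g := by
  have h₁ : cokerMap f = cokerMap g ↔ ∃ h, f.f₀ - g.f₀ = h ≫ Y.d ∧ f.f₁ - g.f₁ = X.d ≫ h := by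
    constructor
    · intro e
      have e' : (f.f₀ - g.f₀) ≫ Y.π = 0 := by
        rw [Preadditive.sub_comp, sub_eq_zero]
        simpa using congrArg (X.π ≫ ·) e
      obtain ⟨h, e''⟩ := exists_of_comp_π_eq_zero Y _ e'
      refine ⟨h, e''.symm, ?_⟩
      rw [← cancel_mono Y.d, Preadditive.sub_comp, f.comm, g.comm, Category.assoc, e'',
        Preadditive.comp_sub]
    · rintro ⟨h, e, -⟩
      have e' : (f.f₀ - g.f₀) ≫ Y.π = 0 := by rw [e, Category.assoc, cokernel.condition, comp_zero]
      rw [Preadditive.sub_comp, sub_eq_zero] at e'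
      ext
      simpa using e'
  have h₂ : extMap (f.s ≫ Y.π) = extMap (g.s ≫ Y.π) ↔
      ∃ k l, f.s - g.s = X.d ≫ k + l ≫ Y.d := by
    have : extMap (f.s ≫ Y.π) - extMap (g.s ≫ Y.π) = extMap ((f.s - g.s) ≫ Y.π) := by
      rw [sub_eq_iff_eq_add, ← extMap_add, ← Preadditive.add_comp, sub_add_cancel]
    rw [← sub_eq_zero, this, extMap_eq_zero_iff]
    constructor
    · rintro ⟨v, hv⟩
      -- Lifting `v` through `π` gives `k`; what remains is killed by `π`, so it comes from `Y₁`,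
      -- which gives `l`.
      have e : (f.s - g.s - X.d ≫ Projective.factorThru v Y.π) ≫ Y.π = 0 := by
        rw [Preadditive.sub_comp, Category.assoc, Projective.factorThru_comp, hv, sub_self]
      obtain ⟨l, hl⟩ := exists_of_comp_π_eq_zero Y _ e
      exact ⟨_, l, by rw [hl, add_sub_cancel]⟩
    · rintro ⟨k, l, e⟩
      exact ⟨k ≫ Y.π, by rw [e, Preadditive.add_comp, Category.assoc, Category.assoc,
        cokernel.condition, comp_zero, add_zero]⟩
  refine (OrbitCat.homOf_add_homOf_eq_iff zero_ne_one _ _ _ _).trans ?_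
  rw [h₂]
  refine Iff.trans (and_congr_left' (Iff.trans ?_ h₁)) ?_
  · rw [← (singleFunctor C 0).map_injective.eq_iff]
    exact (ShiftedHom.homEquiv (0 : ℤ) rfl).injective.eq_iff
  · constructor
    · rintro ⟨⟨h, e, e'⟩, k, l, e''⟩
      exact ⟨h, k, l, e, e', e''⟩
    · rintro ⟨h, k, l, e, e', e''⟩
      exact ⟨⟨h, e, e'⟩, k, l, e''⟩

end TwoTerm

namespace TwoTerm

variable {C : Type u} [Category.{v} C] [Abelian C] [IsHereditary C] [EnoughProjectives C]

lemma exists_iso_coker (A : C) : ∃ X : TwoTerm C, Nonempty (X.coker ≅ A) := by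
  have : Projective (kernel (Projective.π A)) :=
    IsHereditary.projective_of_mono (kernel.ι (Projective.π A))
  exact ⟨⟨_, _, kernel.ι (Projective.π A)⟩, ⟨(colimit.isColimit _).coconePointUniqueUpToIso
    (Abelian.epiIsCokernelOfKernel _ (kernelIsKernel (Projective.π A)))⟩⟩

end TwoTerm

/-! ### Splitting of bounded objects in the hereditary case. -/

namespace DerivedCategory

variable {C : Type u} [Category.{v} C] [Abelian C] [HasDerivedCategory.{w} C]

lemma nonempty_proj_singleFunctor_iso (A : C) (n : ℤ) :
    Nonempty ((OrbitCat.proj (DerivedCategory C)).obj ((singleFunctor C n).obj A) ≅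
      (OrbitCat.proj (DerivedCategory C)).obj ((singleFunctor C 0).obj A)) := by
  obtain ⟨e⟩ := OrbitCat.nonempty_iso_of_iso_shift
    (((singleFunctors C).shiftIso n 0 n (by simp)).symm.app A)
  exact ⟨e.symm⟩

variable [IsHereditary C] [EnoughProjectives C]

lemma from_singleFunctor_obj_eq_zero_of_isLE (A : C) {W : DerivedCategory C} (i n : ℤ)
    (hn : n + 1 < i) [W.IsLE n] (f : (singleFunctor C i).obj A ⟶ W) : f = 0 := by
  obtain ⟨X, ⟨e⟩⟩ := TwoTerm.exists_iso_coker A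
  have : (W⟦i⟧).IsLE (n - i) := TStructure.t.isLE_shift _ n i (n - i)
  let e' : (singleFunctor C 0).obj X.coker ≅ ((singleFunctor C i).obj A)⟦i⟧ :=
    (singleFunctor C 0).mapIso e ≪≫
      ((singleFunctors C).shiftIso i 0 i (by simp)).symm.app A
  apply (shiftFunctor (DerivedCategory C) i).map_injective
  rw [← cancel_epi e'.hom, Functor.map_zero, comp_zero]
  exact X.from_singleFunctor_obj_coker_eq_zero (n - i) (by lia) _

/-- An object of the derived category whose cohomology is concentrated in finitely many degrees
is isomorphic, in the orbit category, to an object concentrated in degree zero. -/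
lemma exists_proj_iso_singleFunctor (k : ℕ) (a : ℤ) (X : DerivedCategory C) [X.IsGE a]
    [X.IsLE (a - 1 + k)] :
    ∃ A : C, Nonempty ((OrbitCat.proj (DerivedCategory C)).obj X ≅
      (OrbitCat.proj (DerivedCategory C)).obj ((singleFunctor C 0).obj A)) := by
  -- The number `k` counts the degrees `a, …, a + k - 1` that may carry cohomology. The inductive
  -- step splits off the top one by truncation.
  induction k generalizing X with
  | zero =>
    have hX : IsZero X := TStructure.t.isZero X (a - 1 + (0 : ℕ)) a (by simp)
    exact ⟨0, ⟨(OrbitCat.proj _).mapIso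
      (hX.iso ((singleFunctor C 0).map_isZero (isZero_zero C)))⟩⟩
  | succ k ih =>
    obtain ⟨Y, Z, hY, hZ, f, g, h, hT⟩ :=
      TStructure.t.exists_triangle X (a - 1 + k) (a + k) (by lia)
    have : Y.IsLE (a - 1 + k) := ⟨hY⟩
    have : Z.IsGE (a + k) := ⟨hZ⟩
    have : X.IsLE (a + k) := TStructure.t.isLE_of_le X (a - 1 + (k + 1 : ℕ)) (a + k) (by lia)
    have : (Y⟦(1 : ℤ)⟧).IsLE (a - 2 + k) :=
      TStructure.t.isLE_shift Y (a - 1 + k) 1 (a - 2 + k) (by lia)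
    have : Z.IsLE (a + k) := TStructure.t.isLE₂ _ (rot_of_distTriang _ hT) (a + k)
      ‹X.IsLE (a + k)› (TStructure.t.isLE_of_le (Y⟦(1 : ℤ)⟧) (a - 2 + k) (a + k) (by lia))
    have : (Z⟦(-1 : ℤ)⟧).IsGE (a + k + 1) :=
      TStructure.t.isGE_shift Z (a + k) (-1) (a + k + 1) (by lia)
    have : Y.IsGE a := TStructure.t.isGE₂ _ (inv_rot_of_distTriang _ hT) a
      (TStructure.t.isGE_of_ge (Z⟦(-1 : ℤ)⟧) a (a + k + 1) (by lia)) ‹X.IsGE a›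
    obtain ⟨A, ⟨e⟩⟩ := ih Y
    obtain ⟨B, ⟨e'⟩⟩ := Z.exists_iso_singleFunctor_obj_of_isGE_of_isLE (a + k)
    -- `Z` sits in degree `a + k` and `Y⟦1⟧` in degrees at most `a + k - 2`, so `h` only involves
    -- `Ext` groups of degree at least two.
    have hh : h = 0 := by
      rw [← cancel_epi e'.inv, comp_zero]
      exact from_singleFunctor_obj_eq_zero_of_isLE B (a + k) (a - 2 + k) (by lia) _
    obtain ⟨φ, -⟩ := exists_iso_binaryBiproduct_of_distTriang _ hT hh
    obtain ⟨e''⟩ := nonempty_proj_singleFunctor_iso B (a + k)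
    have := preservesBinaryBiproduct_of_preservesBiproduct (singleFunctor C 0) A B
    exact ⟨A ⊞ B, ⟨(OrbitCat.proj _).mapIso φ ≪≫
      Functor.Additive.mapBiprodIso (OrbitCat.proj _) e ((OrbitCat.proj _).mapIso e' ≪≫ e'') ≪≫
      (OrbitCat.proj _).mapIso ((singleFunctor C 0).mapBiprod A B).symm⟩⟩

variable (C) in
/-- The orbit category of the bounded derived category of a hereditary abelian category is
equivalent to the homotopy category of perfect differential structures. -/
theorem nonempty_orbitCat_bounded_equivalence :
    Nonempty (OrbitCat (Bounded C) ≌ DiffStr.HomotopyCat C) := by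
  obtain ⟨e⟩ := nonempty_equivalence_of_full_of_essImage (TwoTerm.toHomotopyCat C)
    (TwoTerm.toOrbitCat C) (OrbitCat.mapFunctor (Bounded.ι (C := C)))
    (fun X => ⟨⟨(singleFunctor C 0).obj X.coker, ⟨0, inferInstance⟩, ⟨0, inferInstance⟩⟩,
      ⟨Iso.refl _⟩⟩)
    (by
      rintro ⟨X, ⟨a, ha⟩, ⟨b, hb⟩⟩
      have : X.IsLE (a - 1 + (b - a + 1).toNat) :=
        TStructure.t.isLE_of_le X b _ (by lia)
      obtain ⟨A, ⟨e⟩⟩ := exists_proj_iso_singleFunctor (b - a + 1).toNat a X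
      obtain ⟨T, ⟨e'⟩⟩ := TwoTerm.exists_iso_coker A
      exact ⟨T, ⟨(singleFunctor C 0 ⋙ OrbitCat.proj _).mapIso e' ≪≫ e.symm⟩⟩)
    (fun f g => (TwoTerm.toHomotopyCat_map_eq_iff f g).trans
      (TwoTerm.toOrbitCat_map_eq_iff f g).symm)
  exact ⟨e.symm⟩

end DerivedCategory

/-! ### Projective objects among finitely generated modules. -/

namespace FGModuleCat

section

variable {R : Type u} [Ring R]

/-- The morphism of finitely generated modules given by a linear map. -/
abbrev homMk {M N : FGModuleCat.{u} R} (f : M →ₗ[R] N) : M ⟶ N :=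
  ObjectProperty.homMk (ModuleCat.ofHom f)

lemma projective_of_module_projective [IsNoetherianRing R] (M : FGModuleCat.{u} R)
    [Module.Projective R M] :
    Projective M where
  factors {E X} f e _ := by
    have he : Function.Surjective e.hom.hom :=
      (ModuleCat.epi_iff_surjective ((forget₂ (FGModuleCat R) (ModuleCat R)).map e)).1
        inferInstance
    obtain ⟨g, hg⟩ := Module.projective_lifting_property e.hom.hom f.hom.hom he
    exact ⟨homMk g, hom_ext hg⟩

lemma epi_of_surjective {M N : FGModuleCat.{u} R} (f : M ⟶ N)
    (hf : Function.Surjective f.hom.hom) : Epi f :=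
  ⟨fun a b h => hom_ext (LinearMap.ext fun x => by
    obtain ⟨y, rfl⟩ := hf x
    exact congrArg (fun t => t.hom.hom y) h)⟩

lemma exists_surjective_from_free (M : FGModuleCat.{u} R) :
    ∃ (P : FGModuleCat.{u} R) (f : P ⟶ M), Module.Free R P ∧ Function.Surjective f.hom.hom := by
  obtain ⟨n, f, hf⟩ := Module.Finite.exists_fin' R M
  exact ⟨of R (Fin n → R), homMk (M := of R (Fin n → R)) f,
    inferInstanceAs (Module.Free R (Fin n → R)), hf⟩

lemma module_projective_of_projective (M : FGModuleCat.{u} R) [Projective M] :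
    Module.Projective R M := by
  obtain ⟨P, f, hP, hf⟩ := exists_surjective_from_free M
  have := epi_of_surjective f hf
  exact Module.Projective.of_split (Projective.factorThru (𝟙 M) f).hom.hom f.hom.hom
    (congrArg (fun t => t.hom.hom) (Projective.factorThru_comp (𝟙 M) f))

instance [IsNoetherianRing R] : EnoughProjectives (FGModuleCat.{u} R) where
  presentation M := by
    obtain ⟨P, f, hP, hf⟩ := exists_surjective_from_free M
    have : Module.Projective R P := Module.Projective.of_free
    have := projective_of_module_projective P
    have := epi_of_surjective f hf
    exact ⟨ProjectivePresentation.mk P f⟩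

end

instance : IsHereditary (FGModuleCat.{0} ℤ) where
  projective_of_mono {X Y} f _ _ := by
    have hf : Function.Injective f.hom.hom :=
      (ModuleCat.mono_iff_injective ((forget₂ (FGModuleCat ℤ) (ModuleCat ℤ)).map f)).1
        inferInstance
    have := module_projective_of_projective Y
    have : Module.IsTorsionFree ℤ X := hf.moduleIsTorsionFree f.hom.hom f.hom.hom.map_smul
    exact projective_of_module_projective X

end FGModuleCat

/-! ### Modules over the dual integers as differential structures. -/

namespace DualNumber

lemma smul_eq {M : Type*} [AddCommGroup M] [Module ℤ[ε] M] (r : ℤ[ε]) (x : M) :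
    r • x = r.fst • x + r.snd • (ε : ℤ[ε]) • x := by
  have h : r = r.fst • (1 : ℤ[ε]) + r.snd • (ε : ℤ[ε]) := by
    ext <;> simp
  conv_lhs => rw [h]
  rw [add_smul, smul_assoc, smul_assoc, one_smul]

lemma eps_smul_eps_smul {M : Type*} [AddCommGroup M] [Module ℤ[ε] M] (x : M) :
    (ε : ℤ[ε]) • (ε : ℤ[ε]) • x = 0 := by
  rw [← mul_smul, eps_mul_eps, zero_smul]

instance : Module.Finite ℤ ℤ[ε] := inferInstanceAs (Module.Finite ℤ (ℤ × ℤ))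

instance : IsNoetherianRing ℤ[ε] := isNoetherian_of_tower ℤ inferInstance

instance (M : FGModuleCat.{0} ℤ[ε]) : Module.Finite ℤ M := Module.Finite.trans ℤ[ε] M

/-- The multiplication by `ε`. -/
def epsMul (M : Type*) [AddCommGroup M] [Module ℤ[ε] M] : M →ₗ[ℤ] M :=
  AddMonoidHom.toIntLinearMap (DistribSMul.toAddMonoidHom M (ε : ℤ[ε]))

@[simp] lemma epsMul_apply {M : Type*} [AddCommGroup M] [Module ℤ[ε] M] (x : M) :
    epsMul M x = (ε : ℤ[ε]) • x := rfl

/-- An additive map commuting with the multiplication by `ε` is linear over the dual integers. -/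
def linearMapMk {M N : Type*} [AddCommGroup M] [Module ℤ[ε] M] [AddCommGroup N] [Module ℤ[ε] N]
    (f : M →ₗ[ℤ] N) (h : ∀ x, f ((ε : ℤ[ε]) • x) = (ε : ℤ[ε]) • f x) : M →ₗ[ℤ[ε]] N where
  toFun := f
  map_add' := f.map_add
  map_smul' r x := by
    rw [smul_eq, map_add, map_zsmul, map_zsmul, h, RingHom.id_apply, smul_eq r (f x)]

/-- A module over the dual integers, as a finitely generated abelian group with the
multiplication by `ε`. -/
@[simps]
def toDiffStr : FGModuleCat.{0} ℤ[ε] ⥤ DiffStr (FGModuleCat.{0} ℤ) where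
  obj M :=
    { obj := FGModuleCat.of ℤ M
      d := FGModuleCat.homMk (M := FGModuleCat.of ℤ M) (N := FGModuleCat.of ℤ M) (epsMul M)
      d_d := FGModuleCat.hom_ext (LinearMap.ext fun x => eps_smul_eps_smul x) }
  map {M N} f := ⟨FGModuleCat.homMk (M := FGModuleCat.of ℤ M) (N := FGModuleCat.of ℤ N)
      (f.hom.hom.toAddMonoidHom.toIntLinearMap),
    FGModuleCat.hom_ext (LinearMap.ext fun x => (f.hom.hom.map_smul (ε : ℤ[ε]) x).symm)⟩

instance : toDiffStr.Additive where
  map_add := rfl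

instance : toDiffStr.Faithful where
  map_injective h := FGModuleCat.hom_ext (LinearMap.ext fun x =>
    congrArg (fun t => t.f.hom.hom x) h)

instance : toDiffStr.Full where
  map_surjective {M N} f := by
    refine ⟨FGModuleCat.homMk (linearMapMk f.f.hom.hom fun x => ?_), ?_⟩
    · exact (congrArg (fun t => t.hom.hom x) (DiffStr.comm' f)).symm
    · rfl

@[simp] lemma linearMapMk_apply {M N : Type*} [AddCommGroup M] [Module ℤ[ε] M] [AddCommGroup N]
    [Module ℤ[ε] N] (f : M →ₗ[ℤ] N) (h : ∀ x, f ((ε : ℤ[ε]) • x) = (ε : ℤ[ε]) • f x) (x : M) :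
    linearMapMk f h x = f x := rfl

/-- The abelian group underlying a differential structure. -/
def OfDiffStr (N : DiffStr (FGModuleCat.{0} ℤ)) : Type := N.obj

instance (N : DiffStr (FGModuleCat.{0} ℤ)) : AddCommGroup (OfDiffStr N) :=
  inferInstanceAs (AddCommGroup N.obj)

/-- The differential of a differential structure, as an additive map. -/
def OfDiffStr.d (N : DiffStr (FGModuleCat.{0} ℤ)) : OfDiffStr N →+ OfDiffStr N :=
  N.d.hom.hom.toAddMonoidHom

@[simp] lemma OfDiffStr.d_d {N : DiffStr (FGModuleCat.{0} ℤ)} (x : OfDiffStr N) :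
    d N (d N x) = 0 :=
  congrArg (fun t => t.hom.hom x) N.d_d

/-- The abelian group underlying a differential structure is a module over the dual integers,
with `ε` acting as the differential. -/
instance (N : DiffStr (FGModuleCat.{0} ℤ)) : Module ℤ[ε] (OfDiffStr N) where
  smul r x := r.fst • x + r.snd • OfDiffStr.d N x
  one_smul x := by
    change (1 : ℤ[ε]).fst • x + (1 : ℤ[ε]).snd • OfDiffStr.d N x = x
    simp
  mul_smul r s x := by
    change (r * s).fst • x + (r * s).snd • OfDiffStr.d N x =
      r.fst • (s.fst • x + s.snd • OfDiffStr.d N x) +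
        r.snd • OfDiffStr.d N (s.fst • x + s.snd • OfDiffStr.d N x)
    simp only [TrivSqZeroExt.fst_mul, snd_mul, map_add, map_zsmul, OfDiffStr.d_d, smul_zero, smul_add,
      add_smul, mul_smul, add_zero, add_assoc]
  smul_zero r := by
    change r.fst • (0 : OfDiffStr N) + r.snd • OfDiffStr.d N 0 = 0
    simp
  smul_add r x y := by
    change r.fst • (x + y) + r.snd • OfDiffStr.d N (x + y) = (r.fst • x + r.snd • OfDiffStr.d N x) +
      (r.fst • y + r.snd • OfDiffStr.d N y)
    simp only [map_add, smul_add]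
    abel
  add_smul r s x := by
    change (r + s).fst • x + (r + s).snd • OfDiffStr.d N x = (r.fst • x + r.snd • OfDiffStr.d N x) +
      (s.fst • x + s.snd • OfDiffStr.d N x)
    simp only [TrivSqZeroExt.fst_add, TrivSqZeroExt.snd_add, add_smul]
    abel
  zero_smul x := by
    change (0 : ℤ[ε]).fst • x + (0 : ℤ[ε]).snd • OfDiffStr.d N x = 0
    simp

instance (N : DiffStr (FGModuleCat.{0} ℤ)) : Module.Finite ℤ (OfDiffStr N) := by
  -- The bundled `ℤ`-action and the canonical one agree only propositionally.
  have : AddCommGroup.toIntModule N.obj = N.obj.obj.isModule := Subsingleton.elim _ _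
  change @Module.Finite ℤ N.obj _ _ (AddCommGroup.toIntModule _)
  rw [this]
  exact N.obj.property

instance (N : DiffStr (FGModuleCat.{0} ℤ)) : Module.Finite ℤ[ε] (OfDiffStr N) :=
  Module.Finite.of_restrictScalars_finite ℤ ℤ[ε] _

instance : toDiffStr.EssSurj where
  mem_essImage N := by
    refine ⟨FGModuleCat.of ℤ[ε] (OfDiffStr N), ⟨DiffStr.isoMk
      { hom := FGModuleCat.homMk (M := FGModuleCat.of ℤ (OfDiffStr N)) (N := N.obj)
          { toFun := id, map_add' := fun _ _ => rfl, map_smul' := fun n x => ?_ }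
        inv := FGModuleCat.homMk (M := N.obj) (N := FGModuleCat.of ℤ (OfDiffStr N))
          { toFun := id, map_add' := fun _ _ => rfl, map_smul' := fun n x => ?_ }
        hom_inv_id := rfl
        inv_hom_id := rfl } ?_⟩⟩
    · exact (int_smul_eq_zsmul N.obj.obj.isModule n x).symm
    · exact int_smul_eq_zsmul N.obj.obj.isModule n x
    · refine FGModuleCat.hom_ext (LinearMap.ext fun (x : OfDiffStr N) => ?_)
      change OfDiffStr.d N x = (ε : ℤ[ε]).fst • x + (ε : ℤ[ε]).snd • OfDiffStr.d N x
      simp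

instance : toDiffStr.IsEquivalence where

end DualNumber

/-! ### Torsionless, `ℤ`-projective and Gorenstein-projective modules coincide. -/

namespace DualNumber

instance : Module.Free ℤ ℤ[ε] := inferInstanceAs (Module.Free ℤ (ℤ × ℤ))

lemma module_projective_int_of_injective {M N : Type*} [AddCommGroup M] [AddCommGroup N]
    [Module.Finite ℤ M] [Module.Projective ℤ N] (f : M →ₗ[ℤ] N) (hf : Function.Injective f) :
    Module.Projective ℤ M := by
  have : Module.IsTorsionFree ℤ M := hf.moduleIsTorsionFree f f.map_smul
  infer_instance

/-- A finitely generated module over the dual integers is torsionless if and only if its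
underlying abelian group is projective. -/
lemma isTorsionless_iff (M : FGModuleCat.{0} ℤ[ε]) :
    IsTorsionless ℤ[ε] M ↔ Module.Projective ℤ M := by
  constructor
  · rintro ⟨n, f, hf⟩
    exact module_projective_int_of_injective f.toAddMonoidHom.toIntLinearMap hf
  · intro
    have : Module.Free ℤ M := Module.free_of_finite_type_torsion_free'
    let b := Module.finBasis ℤ M
    -- An additive map `b : M → ℤ` extends to the `ℤ[ε]`-linear map `x ↦ b (ε x) + b x ε`. Its
    -- `ε`-coefficient is `b`, so the coordinates of a `ℤ`-basis give an injection.
    refine ⟨_, LinearMap.pi fun i => linearMapMk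
      ((TrivSqZeroExt.inlHom ℤ ℤ).toAddMonoidHom.toIntLinearMap ∘ₗ b.coord i ∘ₗ epsMul M +
        (TrivSqZeroExt.inrHom ℤ ℤ).toAddMonoidHom.toIntLinearMap ∘ₗ b.coord i) fun x => ?_, ?_⟩
    · ext <;> simp [eps_smul_eps_smul]
    · intro x y h
      refine b.ext_elem fun i => ?_
      simpa using congrArg (fun t : Fin _ → ℤ[ε] => (t i).snd) h

end DualNumber

lemma isTorsionless_of_injective {R : Type u} [Ring R] (M : FGModuleCat.{u} R) {P : Type u}
    [AddCommGroup P] [Module R P] [Module.Finite R P] [Module.Projective R P] (f : M →ₗ[R] P)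
    (hf : Function.Injective f) : IsTorsionless R M := by
  obtain ⟨n, g, h, -, -, hgh⟩ := Module.Finite.exists_comp_eq_id_of_projective R P
  have hh : Function.Injective h := Function.LeftInverse.injective (LinearMap.congr_fun hgh)
  exact ⟨n, h ∘ₗ f, hh.comp hf⟩

lemma isTorsionless_of_isGorensteinProjective {R : Type u} [CommRing R] (M : FGModuleCat.{u} R)
    (hM : IsGorensteinProjective R M) : IsTorsionless R M := by
  obtain ⟨P, d, hP, -, -, ⟨e⟩⟩ := hM
  have := hP 0
  exact isTorsionless_of_injective M ((LinearMap.ker (d 0)).subtype ∘ₗ e.toLinearMap)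
    (Subtype.val_injective.comp e.injective)

namespace DualNumber

open TensorProduct

variable {M : Type} [AddCommGroup M]

lemma exists_eq_tmul_add_tmul (z : ℤ[ε] ⊗[ℤ] M) :
    ∃ a b : M, z = (1 : ℤ[ε]) ⊗ₜ a + (ε : ℤ[ε]) ⊗ₜ b := by
  induction z with
  | zero => exact ⟨0, 0, by simp⟩
  | add z w hz hw =>
    obtain ⟨a, b, rfl⟩ := hz
    obtain ⟨a', b', rfl⟩ := hw
    exact ⟨a + a', b + b', by simp only [tmul_add]; abel⟩
  | tmul r x =>
    refine ⟨r.fst • x, r.snd • x, ?_⟩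
    rw [← smul_tmul, ← smul_tmul, ← add_tmul]
    congr 1
    ext <;> simp

variable (M) in
/-- The coefficient of `ε`. -/
def tensorSnd : ℤ[ε] ⊗[ℤ] M →ₗ[ℤ] M :=
  TensorProduct.lift ((LinearMap.lsmul ℤ M).comp (TrivSqZeroExt.sndHom ℤ ℤ))

@[simp]
lemma tensorSnd_tmul (r : ℤ[ε]) (x : M) : tensorSnd M (r ⊗ₜ x) = r.snd • x := rfl

variable (M) [Module ℤ[ε] M]

/-- The differential of the complete resolution of `M`, up to the choice of a sign `s`. -/
def resolutionD (s : ℤ) : ℤ[ε] ⊗[ℤ] M →ₗ[ℤ[ε]] ℤ[ε] ⊗[ℤ] M :=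
  LinearMap.liftBaseChange ℤ[ε]
    (s • (TensorProduct.mk ℤ ℤ[ε] M 1 ∘ₗ epsMul M) + TensorProduct.mk ℤ ℤ[ε] M ε)

variable {M}

lemma resolutionD_tmul (s : ℤ) (r : ℤ[ε]) (x : M) :
    resolutionD M s (r ⊗ₜ x) = s • (r ⊗ₜ[ℤ] ((ε : ℤ[ε]) • x)) + (r * ε) ⊗ₜ x := by
  simp [resolutionD, smul_tmul']

/-- The two actions of `ε` on `ℤ[ε] ⊗ M` commute and square to zero, so the cross terms of the
product cancel for opposite signs. -/
lemma resolutionD_comp (s : ℤ) (z : ℤ[ε] ⊗[ℤ] M) :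
    resolutionD M s (resolutionD M (-s) z) = 0 := by
  induction z with
  | zero => simp
  | add z w hz hw => rw [map_add, map_add, hz, hw, add_zero]
  | tmul r x =>
    simp [resolutionD_tmul, eps_smul_eps_smul, mul_assoc]

/-- The `ε`-coefficient of the hypothesis reads `a + s ε b = 0`, so `b` determines the cycle. -/
lemma eq_resolutionD_of_resolutionD_eq_zero (s : ℤ) (a b : M)
    (h : resolutionD M s ((1 : ℤ[ε]) ⊗ₜ a + (ε : ℤ[ε]) ⊗ₜ b) = 0) :
    (1 : ℤ[ε]) ⊗ₜ a + (ε : ℤ[ε]) ⊗ₜ b = resolutionD M (-s) ((1 : ℤ[ε]) ⊗ₜ b) := by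
  have h' := congrArg (tensorSnd M) h
  simp only [map_add, resolutionD_tmul, map_zsmul, tensorSnd_tmul] at h'
  have ha : a = -(s • (ε : ℤ[ε]) • b) := by
    rw [eq_neg_iff_add_eq_zero]
    simpa using h'
  rw [ha, resolutionD_tmul]
  simp [tmul_neg]

lemma exact_resolutionD (s : ℤ) :
    Function.Exact (resolutionD M (-s)) (resolutionD M s) := by
  intro z
  constructor
  · intro h
    obtain ⟨a, b, rfl⟩ := exists_eq_tmul_add_tmul z
    exact ⟨_, (eq_resolutionD_of_resolutionD_eq_zero s a b h).symm⟩
  · rintro ⟨z, rfl⟩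
    exact resolutionD_comp s z

/-- Dual of the previous argument: if `φ` kills the image of the differential, the constant term of
`φ (1 ⊗ x)` is determined by `ε`-coefficients. The preimage of `φ` sends `1 ⊗ x` to the
`ε`-coefficient of `φ (1 ⊗ x)`, taken as an integer. -/
lemma exact_dualMap_resolutionD (s : ℤ) :
    Function.Exact (resolutionD M (-s)).dualMap (resolutionD M s).dualMap := by
  intro φ
  constructor
  · intro h
    have h₀ (x : M) : (φ ((1 : ℤ[ε]) ⊗ₜ x)).fst =
        -(s • (φ ((1 : ℤ[ε]) ⊗ₜ ((ε : ℤ[ε]) • x))).snd) := by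
      have h₁ : φ (resolutionD M s ((1 : ℤ[ε]) ⊗ₜ x)) = 0 := LinearMap.congr_fun h _
      have h₂ : φ ((ε : ℤ[ε]) ⊗ₜ x) = ε * φ ((1 : ℤ[ε]) ⊗ₜ x) := by
        rw [← smul_eq_mul, ← map_smul, smul_tmul', smul_eq_mul, mul_one]
      have h₃ := congrArg TrivSqZeroExt.snd h₁
      rw [resolutionD_tmul, map_add, map_zsmul, one_mul, h₂] at h₃
      rw [eq_neg_iff_add_eq_zero, add_comm]
      simpa using h₃
    refine ⟨LinearMap.liftBaseChange ℤ[ε]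
      ((TrivSqZeroExt.inlHom ℤ ℤ).toAddMonoidHom.toIntLinearMap ∘ₗ TrivSqZeroExt.sndHom ℤ ℤ ∘ₗ
        φ.restrictScalars ℤ ∘ₗ
        TensorProduct.mk ℤ ℤ[ε] M 1), ?_⟩
    refine TensorProduct.AlgebraTensorModule.ext fun r x => ?_
    have hr : r ⊗ₜ[ℤ] x = r • ((1 : ℤ[ε]) ⊗ₜ[ℤ] x) := by rw [smul_tmul', smul_eq_mul, mul_one]
    rw [hr, map_smul, map_smul]
    congr 1
    rw [LinearMap.dualMap_apply, resolutionD_tmul]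
    ext
    · simp only [map_add, map_zsmul, LinearMap.liftBaseChange_tmul, one_mul, one_smul]
      simp [h₀]
      exact Or.inl rfl
    · simp
      rfl
  · rintro ⟨ψ, rfl⟩
    refine LinearMap.ext fun z => ?_
    have h := resolutionD_comp (-s) z
    rw [neg_neg] at h
    rw [LinearMap.dualMap_apply, LinearMap.dualMap_apply, h, map_zero, LinearMap.zero_apply]

variable (M) in
/-- A module over the dual integers is the kernel of a differential of its complete resolution. -/
def equivKer : M ≃ₗ[ℤ[ε]] LinearMap.ker (resolutionD M (-1)) :=
  LinearEquiv.ofBijective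
    -- The map is `x ↦ 1 ⊗ ε x + ε ⊗ x`; the sign `s = 1` is what makes it `ℤ[ε]`-linear.
    (LinearMap.codRestrict _ (linearMapMk
      ((resolutionD M 1).restrictScalars ℤ ∘ₗ TensorProduct.mk ℤ ℤ[ε] M 1)
      fun x => by
        change resolutionD M 1 (1 ⊗ₜ ((ε : ℤ[ε]) • x)) = (ε : ℤ[ε]) • resolutionD M 1 (1 ⊗ₜ x)
        simp [resolutionD_tmul, smul_tmul', eps_smul_eps_smul])
      fun x => resolutionD_comp (-1) ((1 : ℤ[ε]) ⊗ₜ x))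
    ⟨fun x y h => by
      have h' := congrArg (fun t => tensorSnd M t.1) h
      change tensorSnd M (resolutionD M 1 (1 ⊗ₜ x)) = tensorSnd M (resolutionD M 1 (1 ⊗ₜ y)) at h'
      simpa [resolutionD_tmul] using h',
    fun ⟨z, hz⟩ => by
      obtain ⟨a, b, rfl⟩ := exists_eq_tmul_add_tmul z
      exact ⟨b, Subtype.ext (eq_resolutionD_of_resolutionD_eq_zero (-1) a b hz).symm⟩⟩

lemma isGorensteinProjective_of_isTorsionless (M : FGModuleCat.{0} ℤ[ε])
    (hM : IsTorsionless ℤ[ε] M) : IsGorensteinProjective ℤ[ε] M := by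
  have := (isTorsionless_iff M).1 hM
  have hs (i : ℤ) : ((i + 1).negOnePow : ℤ) = -(i.negOnePow : ℤ) := by
    rw [Int.negOnePow_succ, Units.val_neg]
  -- Signs alternate so that consecutive differentials compose to zero; the sign in degree zero is
  -- `-1`, as `equivKer` requires.
  refine ⟨fun _ => FGModuleCat.of ℤ[ε] (ℤ[ε] ⊗[ℤ] M), fun i => resolutionD M (-i.negOnePow),
    fun i => inferInstanceAs (Module.Projective ℤ[ε] (ℤ[ε] ⊗[ℤ] M)), fun i => ?_, fun i => ?_, ?_⟩
  · dsimp only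
    rw [hs, neg_neg]
    exact exact_resolutionD _
  · dsimp only
    rw [hs, neg_neg]
    have := exact_dualMap_resolutionD (M := M) (-(i.negOnePow : ℤ))
    rwa [neg_neg] at this
  · have h : ((0 : ℤ).negOnePow : ℤ) = 1 := by simp
    have key (s : ℤ) (hs : s = 1) :
        Nonempty (M ≃ₗ[ℤ[ε]] LinearMap.ker (resolutionD M (-s))) := by
      subst hs
      exact ⟨equivKer M⟩
    exact key _ h

theorem isGorensteinProjective_eq_isTorsionless :
    IsGorensteinProjective ℤ[ε] = IsTorsionless ℤ[ε] :=
  funext fun M => propext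
    ⟨isTorsionless_of_isGorensteinProjective M, isGorensteinProjective_of_isTorsionless M⟩

/-! ### The stable category of torsionless modules as a homotopy category. -/

lemma isPerfect_toDiffStr_iff (M : FGModuleCat.{0} ℤ[ε]) :
    DiffStr.IsPerfect _ (toDiffStr.obj M) ↔ IsTorsionless ℤ[ε] M := by
  rw [isTorsionless_iff]
  refine ⟨fun h => ?_, fun h => ?_⟩
  · have : Projective (FGModuleCat.of ℤ M) := h
    exact FGModuleCat.module_projective_of_projective (FGModuleCat.of ℤ M)
  · have : Module.Projective ℤ (FGModuleCat.of ℤ M) := h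
    exact FGModuleCat.projective_of_module_projective (FGModuleCat.of ℤ M)

/-- Torsionless modules over the dual integers, as perfect differential structures. -/
def torsionlessToPerfect : (IsTorsionless ℤ[ε]).FullSubcategory ⥤
    (DiffStr.IsPerfect (FGModuleCat.{0} ℤ)).FullSubcategory :=
  ObjectProperty.lift _ (ObjectProperty.ι _ ⋙ toDiffStr)
    fun M => (isPerfect_toDiffStr_iff M.obj).2 M.property

instance : torsionlessToPerfect.Full := by unfold torsionlessToPerfect; infer_instance

instance : torsionlessToPerfect.Faithful := by unfold torsionlessToPerfect; infer_instance

instance : torsionlessToPerfect.Additive where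
  map_add := rfl

lemma exists_torsionlessToPerfect_iso
    (N : (DiffStr.IsPerfect (FGModuleCat.{0} ℤ)).FullSubcategory) :
    ∃ M, Nonempty (torsionlessToPerfect.obj M ≅ N) := by
  let e := toDiffStr.objObjPreimageIso N.obj
  have h : DiffStr.IsPerfect _ (toDiffStr.obj (toDiffStr.objPreimage N.obj)) :=
    Projective.of_iso ⟨e.inv.f, e.hom.f, congrArg DiffStr.Hom.f e.inv_hom_id,
      congrArg DiffStr.Hom.f e.hom_inv_id⟩ N.property
  exact ⟨⟨_, (isPerfect_toDiffStr_iff _).1 h⟩, ⟨ObjectProperty.isoMk _ e⟩⟩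

instance : torsionlessToPerfect.EssSurj := ⟨exists_torsionlessToPerfect_iso⟩

lemma stableRel_torsionlessToPerfect_map_iff {M N : (IsTorsionless ℤ[ε]).FullSubcategory}
    (f g : M ⟶ N) :
    stableRel (DiffStr.IsPerfect _) (torsionlessToPerfect.map f) (torsionlessToPerfect.map g) ↔
      stableRel (IsTorsionless ℤ[ε]) f g := by
  constructor
  · rintro ⟨Q, hQ, a, b, h⟩
    obtain ⟨P, ⟨e⟩⟩ := exists_torsionlessToPerfect_iso Q
    obtain ⟨a', ha⟩ := torsionlessToPerfect.map_surjective (a ≫ e.inv)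
    obtain ⟨b', hb⟩ := torsionlessToPerfect.map_surjective (e.hom ≫ b)
    refine ⟨P, ?_, a', b', torsionlessToPerfect.map_injective ?_⟩
    · rw [← toDiffStr.asEquivalence.map_projective_iff]
      exact Projective.of_iso ((ObjectProperty.ι _).mapIso e).symm hQ
    · rw [Functor.map_comp, ha, hb, Category.assoc, e.inv_hom_id_assoc,
        Functor.map_sub]
      exact h
  · rintro ⟨Q, hQ, a, b, h⟩
    refine ⟨torsionlessToPerfect.obj Q, ?_, torsionlessToPerfect.map a,
      torsionlessToPerfect.map b, ?_⟩
    · exact (toDiffStr.asEquivalence.map_projective_iff _).2 hQ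
    · rw [← Functor.map_comp, ← h, Functor.map_sub]

theorem nonempty_stableCat_isTorsionless_equivalence :
    Nonempty (StableCat (IsTorsionless ℤ[ε]) ≌ DiffStr.HomotopyCat (FGModuleCat.{0} ℤ)) := by
  have h {M N : (IsTorsionless ℤ[ε]).FullSubcategory} (f g : M ⟶ N) :
      DiffStr.homotopyRel _ (torsionlessToPerfect.map f) (torsionlessToPerfect.map g) ↔
        stableRel (IsTorsionless ℤ[ε]) f g := by
    rw [← DiffStr.stableRel_isPerfect]
    exact stableRel_torsionlessToPerfect_map_iff f g
  have h' {M N : (IsTorsionless ℤ[ε]).FullSubcategory} (f g : M ⟶ N) :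
      (torsionlessToPerfect ⋙ Quotient.functor (DiffStr.homotopyRel _)).map f =
        (torsionlessToPerfect ⋙ Quotient.functor (DiffStr.homotopyRel _)).map g ↔
          stableRel (IsTorsionless ℤ[ε]) f g :=
    (Quotient.functor_map_eq_iff _ _ _).trans (h f g)
  -- Stable equality is a congruence because it is the kernel of a functor.
  have : Congruence (stableRel (IsTorsionless ℤ[ε])) := by
    have : stableRel (IsTorsionless ℤ[ε]) =
        (torsionlessToPerfect ⋙ Quotient.functor (DiffStr.homotopyRel _)).homRel := by
      funext M N f g
      exact propext (h' f g).symm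
    rw [this]
    infer_instance
  exact nonempty_equivalence_of_full (Quotient.functor (stableRel (IsTorsionless ℤ[ε])))
    (torsionlessToPerfect ⋙ Quotient.functor (DiffStr.homotopyRel _))
    fun f g => (Quotient.functor_map_eq_iff _ _ _).trans (h' f g).symm

end DualNumber

end

theorem theorem1p1 :
    Nonempty (StableCat (IsGorensteinProjective (DualNumber ℤ)) ≌
      StableCat (IsTorsionless (DualNumber ℤ))) ∧
    Nonempty (StableCat (IsTorsionless (DualNumber ℤ)) ≌ OrbitCat DbInt) ∧
    Nonempty (OrbitCat DbInt ≌ DiffStr.HomotopyCat (FGModuleCat.{0} ℤ)) ∧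
    Nonempty (DiffStr.HomotopyCat (FGModuleCat.{0} ℤ) ≌
      StableCat (DiffStr.IsPerfect (FGModuleCat.{0} ℤ))) := by
  obtain ⟨e⟩ := DualNumber.nonempty_stableCat_isTorsionless_equivalence
  obtain ⟨e'⟩ := DerivedCategory.nonempty_orbitCat_bounded_equivalence (FGModuleCat.{0} ℤ)
  refine ⟨?_, ⟨e.trans e'.symm⟩, ⟨e'⟩, DiffStr.nonempty_homotopyCat_equivalence_stableCat⟩
  rw [DualNumber.isGorensteinProjective_eq_isTorsionless]
  exact ⟨CategoryTheory.Equivalence.refl⟩
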